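/- Let $A$ be a $^*$-algebra over $\mathbb C$, with or without unit, with a non-degenerate product, and let $M(A\otimes A)$ be the multiplier algebra of the algebraic tensor product $A\otimes A$. Let $(A,\Delta)$ be a multiplier Hopf $^*$-algebra: $\Delta:A\to M(A\otimes A)$ is a $^*$-homomorphism such that $\Delta(a)(1\otimes b)$ and $(a\otimes 1)\Delta(b)$ lie in $A\otimes A$ for all $a,b\in A$, which is coassociative in the sense that $$(a\otimes 1\otimes 1)(\Delta\otimes\iota)(\Delta(b)(1\otimes c))=(\iota\otimes\Delta)((a\otimes 1)\Delta(b))(1\otimes 1\otimes c)\qquad (a,b,c\in A),$$ and such that the linear maps $a\otimes b\mapsto\Delta(a)(1\otimes b)$ and $a\otimes b\mapsto(a\otimes 1)\Delta(b)$ are bijections of $A\otimes A$. Let $S:A\to A$ be its antipode. A left integral is a non-zero linear functional $\varphi$ on $A$ with $(\iota\otimes\varphi)\Delta(a)=\varphi(a)1$ for all $a$; a right integral is a non-zero linear functional $\psi$ on $A$ with $(\psi\otimes\iota)\Delta(a)=\psi(a)1$ for all $a$. A linear functional $\omega$ on $A$ is positive if $\omega(a^*a)\ge 0$ for all $a\in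 A$. Suppose that $(A,\Delta)$ has a positive integral, i.e. that some left integral or some right integral on $A$ is positive. Then the scaling constant of $(A,\Delta)$ is equal to $1$. That is: left integrals exist, and for every left integral $\varphi$ there is $\tau\in\mathbb C$ with $\varphi\circ S^2=\tau\varphi$, and every such $\tau$ is equal to $1$. -/

import Mathlib

open scoped TensorProduct

set_option linter.unusedSectionVars false

noncomputable section

namespace VanDaele

section Multipliers

variable (B : Type*) [NonUnitalRing B] [Module ℂ B] [IsScalarTower ℂ B B] [SMulCommClass ℂ B B]

/-- The product of an algebra is non-degenerate. -/
def NondegenerateProduct : Prop :=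
  (∀ a : B, (∀ b : B, a * b = 0) → a = 0) ∧ (∀ b : B, (∀ a : B, a * b = 0) → b = 0)

/-- The (algebraic) multiplier algebra `M(B)` of an algebra `B` with a non-degenerate product:
pairs `(L, R)` of linear maps of `B` with `R x * y = x * L y`. For a multiplier `m = (L, R)` one
writes `m x = L x` and `x m = R x`. The product is `(m n) x = m (n x)` and `x (m n) = (x m) n`.
(By non-degeneracy `L (x y) = L x * y` and `R (x y) = x * R y` are automatic, and each of
`L` and `R` determines the other one.) -/
def multiplierSubalgebra : Subalgebra ℂ (Module.End ℂ B × (Module.End ℂ B)ᵐᵒᵖ) where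
  carrier := {m | ∀ x y : B, m.2.unop x * y = x * m.1 y}
  mul_mem' := by
    intro m n hm hn x y
    simp only [Set.mem_ofPred_eq] at hm hn
    simp [hm, hn]
  add_mem' := by
    intro m n hm hn x y
    simp only [Set.mem_ofPred_eq] at hm hn
    simp [hm, hn, add_mul, mul_add]
  algebraMap_mem' := by
    intro r x y
    simp [Algebra.algebraMap_eq_smul_one, smul_mul_assoc, mul_smul_comm]

/-- The multiplier algebra `M(B)` as a type; it is a unital algebra over `ℂ`. -/
abbrev Multipliers : Type _ := multiplierSubalgebra B

variable {B}

/-- `m x`, for a multiplier `m` of `B` and `x : B`. -/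
def Multipliers.left (m : Multipliers B) : B →ₗ[ℂ] B := m.1.1

/-- `x m`, for a multiplier `m` of `B` and `x : B`. -/
def Multipliers.right (m : Multipliers B) : B →ₗ[ℂ] B := m.1.2.unop

/-- The multiplier given by two linear maps `L` and `R` with `R x * y = x * L y`. -/
def Multipliers.mk (L R : B →ₗ[ℂ] B) (h : ∀ x y : B, R x * y = x * L y) : Multipliers B :=
  ⟨(L, MulOpposite.op R), h⟩

theorem Multipliers.right_mul_eq (m : Multipliers B) (x y : B) :
    m.right x * y = x * m.left y := m.2 x y

/-- The canonical embedding of `B` in `M(B)`. -/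
def Multipliers.of (b : B) : Multipliers B :=
  Multipliers.mk (LinearMap.mulLeft ℂ b) (LinearMap.mulRight ℂ b) (fun x y => by
    simp [mul_assoc])

/-- The linear map `x ↦ (f x⋆)⋆` associated with a linear map `f`. -/
def starConj [StarRing B] [StarModule ℂ B] (f : B →ₗ[ℂ] B) : B →ₗ[ℂ] B where
  toFun x := star (f (star x))
  map_add' x y := by simp
  map_smul' r x := by simp

/-- The involution of `M(B)` when `B` is a `⋆`-algebra: `m⋆ x = (x⋆ m)⋆` and `x m⋆ = (m x⋆)⋆`. -/
instance [StarRing B] [StarModule ℂ B] : Star (Multipliers B) where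
  star m := Multipliers.mk (starConj m.right) (starConj m.left) (fun x y => by
    have h := m.right_mul_eq (star y) (star x)
    have h' := congrArg star h
    simp only [star_mul, star_star] at h'
    simpa [starConj] using h'.symm)

end Multipliers

section Hopf

variable (A : Type*) [NonUnitalRing A] [Module ℂ A] [IsScalarTower ℂ A A] [SMulCommClass ℂ A A]

variable {A} in
/-- The multiplier `1 ⊗ a` of `A ⊗ A`. -/
def oneTmul (a : A) : Multipliers (A ⊗[ℂ] A) :=
  Multipliers.mk (TensorProduct.map LinearMap.id (LinearMap.mulLeft ℂ a))
    (TensorProduct.map LinearMap.id (LinearMap.mulRight ℂ a)) (fun x y => by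
    induction x with
    | zero => simp
    | add x x' hx hx' => simp [add_mul, hx, hx']
    | tmul p q =>
      induction y with
      | zero => simp
      | add y y' hy hy' => simp only [map_add, mul_add, hy, hy']
      | tmul r s => simp [mul_assoc])

variable {A} in
/-- The multiplier `a ⊗ 1` of `A ⊗ A`. -/
def tmulOne (a : A) : Multipliers (A ⊗[ℂ] A) :=
  Multipliers.mk (TensorProduct.map (LinearMap.mulLeft ℂ a) LinearMap.id)
    (TensorProduct.map (LinearMap.mulRight ℂ a) LinearMap.id) (fun x y => by
    induction x with
    | zero => simp
    | add x x' hx hx' => simp [add_mul, hx, hx']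
    | tmul p q =>
      induction y with
      | zero => simp
      | add y y' hy hy' => simp only [map_add, mul_add, hy, hy']
      | tmul r s => simp [mul_assoc])

/-- A multiplier Hopf `⋆`-algebra `(A, Δ)`: a `⋆`-algebra `A` over `ℂ` (with or without unit) with
a non-degenerate product, and a `⋆`-homomorphism `Δ : A → M(A ⊗ A)` such that
* `Δ(a)(1 ⊗ b)` and `(a ⊗ 1)Δ(b)` belong to `A ⊗ A`;
* `Δ` is coassociative:
  `(a ⊗ 1 ⊗ 1)(Δ ⊗ ι)(Δ(b)(1 ⊗ c)) = (ι ⊗ Δ)((a ⊗ 1)Δ(b))(1 ⊗ 1 ⊗ c)`;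
* the linear maps `T₁ : a ⊗ b ↦ Δ(a)(1 ⊗ b)` and `T₂ : a ⊗ b ↦ (a ⊗ 1)Δ(b)` are bijections of
  `A ⊗ A`. -/
structure MultiplierHopfStarAlgebra [StarRing A] [StarModule ℂ A] where
  nondegenerate : NondegenerateProduct A
  /-- the coproduct `Δ` -/
  comul : A →⋆ₙₐ[ℂ] Multipliers (A ⊗[ℂ] A)
  /-- the canonical map `T₁` -/
  T₁ : A ⊗[ℂ] A ≃ₗ[ℂ] A ⊗[ℂ] A
  T₁_spec : ∀ a b : A, Multipliers.of (T₁ (a ⊗ₜ b)) = comul a * oneTmul b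
  /-- the canonical map `T₂` -/
  T₂ : A ⊗[ℂ] A ≃ₗ[ℂ] A ⊗[ℂ] A
  T₂_spec : ∀ a b : A, Multipliers.of (T₂ (a ⊗ₜ b)) = tmulOne a * comul b
  /-- coassociativity; the left hand side is `(a ⊗ 1 ⊗ 1)(Δ ⊗ ι)(Δ(b)(1 ⊗ c))`, and the right
  hand side is `(ι ⊗ Δ)((a ⊗ 1)Δ(b))(1 ⊗ 1 ⊗ c)` -/
  coassoc : ∀ a b c : A,
    T₂.toLinearMap.rTensor A ((TensorProduct.assoc ℂ A A A).symm (a ⊗ₜ T₁ (b ⊗ₜ c))) =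
      (TensorProduct.assoc ℂ A A A).symm
        (T₁.toLinearMap.lTensor A (TensorProduct.assoc ℂ A A A (T₂ (a ⊗ₜ b) ⊗ₜ c)))

end Hopf

namespace MultiplierHopfStarAlgebra

variable {A : Type*} [NonUnitalRing A] [Module ℂ A] [IsScalarTower ℂ A A] [SMulCommClass ℂ A A]
  [StarRing A] [StarModule ℂ A] (H : MultiplierHopfStarAlgebra A)

/-- The slice map `ω ⊗ ι : A ⊗ A → A`. -/
def sliceLeft (ω : A →ₗ[ℂ] ℂ) : A ⊗[ℂ] A →ₗ[ℂ] A :=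
  (TensorProduct.lid ℂ A).toLinearMap ∘ₗ ω.rTensor A

/-- The slice map `ι ⊗ ω : A ⊗ A → A`. -/
def sliceRight (ω : A →ₗ[ℂ] ℂ) : A ⊗[ℂ] A →ₗ[ℂ] A :=
  (TensorProduct.rid ℂ A).toLinearMap ∘ₗ ω.lTensor A

@[simp] theorem sliceLeft_tmul (ω : A →ₗ[ℂ] ℂ) (a b : A) : sliceLeft ω (a ⊗ₜ b) = ω a • b := by
  simp [sliceLeft]

@[simp] theorem sliceRight_tmul (ω : A →ₗ[ℂ] ℂ) (a b : A) : sliceRight ω (a ⊗ₜ b) = ω b • a := by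
  simp [sliceRight]

/-- `ε` is a counit: `(ε ⊗ ι)(Δ(a)(1 ⊗ b)) = ab` and `(ι ⊗ ε)((a ⊗ 1)Δ(b)) = ab`. -/
def IsCounit (ε : A →ₗ[ℂ] ℂ) : Prop :=
  (∀ a b : A, sliceLeft ε (H.T₁ (a ⊗ₜ b)) = a * b) ∧
    ∀ a b : A, sliceRight ε (H.T₂ (a ⊗ₜ b)) = a * b

theorem tensor_ext {x y : A ⊗[ℂ] A} (H : MultiplierHopfStarAlgebra A)
    (h : ∀ z, x * z = y * z) : x = y := by
  have key : ∀ x : A ⊗[ℂ] A,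
      (∀ d, TensorProduct.map LinearMap.id (LinearMap.mulRight ℂ d) x = 0) → x = 0 := by
    intro x hx
    let b := Module.Free.chooseBasis ℂ A
    let e := TensorProduct.equivFinsuppOfBasisLeft (N := A) b
    have he : ∀ (d : A) (x : A ⊗[ℂ] A) i,
        e (TensorProduct.map LinearMap.id (LinearMap.mulRight ℂ d) x) i = e x i * d := by
      intro d x i
      induction x with
      | zero => simp
      | add x y hx hy => simp [hx, hy, add_mul]
      | tmul p q => simp [e, smul_mul_assoc]
    apply e.injective
    ext i
    rw [map_zero]
    apply H.nondegenerate.1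
    intro d
    rw [← he, hx d]; simp
  have key' : ∀ x : A ⊗[ℂ] A,
      (∀ d, TensorProduct.map (LinearMap.mulRight ℂ d) LinearMap.id x = 0) → x = 0 := by
    intro x hx
    apply (TensorProduct.comm ℂ A A).injective
    rw [map_zero]
    apply key
    intro d
    have : ∀ x : A ⊗[ℂ] A, TensorProduct.map LinearMap.id (LinearMap.mulRight ℂ d)
        (TensorProduct.comm ℂ A A x) =
        TensorProduct.comm ℂ A A (TensorProduct.map (LinearMap.mulRight ℂ d) LinearMap.id x) := by
      intro x
      induction x with
      | zero => simp
      | add x y hx hy => simp [hx, hy]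
      | tmul p q => simp
    rw [this, hx d, map_zero]
  rw [← sub_eq_zero]
  apply key
  intro d
  apply key'
  intro c
  have : ∀ x : A ⊗[ℂ] A, TensorProduct.map (LinearMap.mulRight ℂ c) LinearMap.id
      (TensorProduct.map LinearMap.id (LinearMap.mulRight ℂ d) x) = x * (c ⊗ₜ d) := by
    intro x
    induction x with
    | zero => simp
    | add x y hx hy => simp [hx, hy, add_mul]
    | tmul p q => simp
  rw [this, sub_mul, h, sub_self]

theorem of_injective (H : MultiplierHopfStarAlgebra A) {x y : A ⊗[ℂ] A}
    (h : Multipliers.of x = Multipliers.of y) : x = y := by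
  apply H.tensor_ext
  intro z
  exact congrArg (fun m => Multipliers.left m z) h

theorem tensor_ext' {x y : A ⊗[ℂ] A} (H : MultiplierHopfStarAlgebra A)
    (h : ∀ z, z * x = z * y) : x = y := by
  apply star_injective
  apply H.tensor_ext
  intro z
  apply star_injective
  simpa using h (star z)

theorem multipliers_ext {m n : Multipliers (A ⊗[ℂ] A)} (hl : ∀ x, m.left x = n.left x)
    (hr : ∀ x, m.right x = n.right x) : m = n := by
  apply Subtype.ext
  apply Prod.ext
  · exact LinearMap.ext hl
  · exact MulOpposite.unop_injective (LinearMap.ext hr)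

theorem mul_of (H : MultiplierHopfStarAlgebra A) (m : Multipliers (A ⊗[ℂ] A)) (x : A ⊗[ℂ] A) :
    m * Multipliers.of x = Multipliers.of (m.left x) := by
  apply multipliers_ext
  · intro y
    change m.left (x * y) = m.left x * y
    apply H.tensor_ext'
    intro z
    rw [← m.right_mul_eq, ← mul_assoc, ← mul_assoc, m.right_mul_eq]
  · intro y
    exact m.right_mul_eq y x

theorem of_mul (H : MultiplierHopfStarAlgebra A) (m : Multipliers (A ⊗[ℂ] A)) (x : A ⊗[ℂ] A) :
    Multipliers.of x * m = Multipliers.of (m.right x) := by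
  apply multipliers_ext
  · intro y
    exact (m.right_mul_eq x y).symm
  · intro y
    change m.right (y * x) = y * m.right x
    apply H.tensor_ext
    intro z
    rw [m.right_mul_eq, mul_assoc, mul_assoc, m.right_mul_eq]

theorem oneTmul_mul (a b : A) : oneTmul (a * b) = oneTmul a * oneTmul b := by
  apply multipliers_ext
  · intro x
    change TensorProduct.map _ _ x = TensorProduct.map _ _ (TensorProduct.map _ _ x)
    induction x with
    | zero => simp
    | add x y hx hy => simp only [map_add, hx, hy]
    | tmul p q => simp
  · intro x
    change TensorProduct.map _ _ x = TensorProduct.map _ _ (TensorProduct.map _ _ x)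
    induction x with
    | zero => simp
    | add x y hx hy => simp only [map_add, hx, hy]
    | tmul p q => simp [mul_assoc]

theorem tmulOne_mul_oneTmul (a b : A) :
    tmulOne a * oneTmul b = Multipliers.of (a ⊗ₜ[ℂ] b) := by
  apply multipliers_ext
  · intro x
    change TensorProduct.map _ _ (TensorProduct.map _ _ x) = _ * x
    induction x with
    | zero => simp
    | add x y hx hy => simp [hx, hy, mul_add]
    | tmul p q => simp
  · intro x
    change TensorProduct.map _ _ (TensorProduct.map _ _ x) = x * _
    induction x with
    | zero => simp
    | add x y hx hy => simp [hx, hy, add_mul]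
    | tmul p q => simp

theorem oneTmul_mul_tmulOne (a b : A) :
    oneTmul b * tmulOne a = Multipliers.of (a ⊗ₜ[ℂ] b) := by
  apply multipliers_ext
  · intro x
    change TensorProduct.map _ _ (TensorProduct.map _ _ x) = _ * x
    induction x with
    | zero => simp
    | add x y hx hy => simp [hx, hy, mul_add]
    | tmul p q => simp
  · intro x
    change TensorProduct.map _ _ (TensorProduct.map _ _ x) = x * _
    induction x with
    | zero => simp
    | add x y hx hy => simp [hx, hy, add_mul]
    | tmul p q => simp

theorem star_mult_mul (m n : Multipliers (A ⊗[ℂ] A)) : star (m * n) = star n * star m := by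
  apply multipliers_ext
  · intro x
    change star (n.right (m.right (star x))) = star (n.right (star (star (m.right (star x)))))
    rw [star_star]
  · intro x
    change star (m.left (n.left (star x))) = star (m.left (star (star (n.left (star x)))))
    rw [star_star]

theorem star_of (x : A ⊗[ℂ] A) : star (Multipliers.of x) = Multipliers.of (star x) := by
  apply multipliers_ext
  · intro y
    change star (star y * x) = star x * y
    simp
  · intro y
    change star (x * star y) = y * star x
    simp

theorem star_tmulOne (a : A) : star (tmulOne a) = tmulOne (star a) := by
  apply multipliers_ext
  · intro x
    change star (TensorProduct.map (LinearMap.mulRight ℂ a) LinearMap.id (star x)) =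
      TensorProduct.map (LinearMap.mulLeft ℂ (star a)) LinearMap.id x
    induction x with
    | zero => simp
    | add x y hx hy => rw [star_add, map_add, star_add, hx, hy, map_add]
    | tmul p q => simp
  · intro x
    change star (TensorProduct.map (LinearMap.mulLeft ℂ a) LinearMap.id (star x)) =
      TensorProduct.map (LinearMap.mulRight ℂ (star a)) LinearMap.id x
    induction x with
    | zero => simp
    | add x y hx hy => rw [star_add, map_add, star_add, hx, hy, map_add]
    | tmul p q => simp

theorem comul_left_T₁ (a c d : A) :
    (H.comul a).left (H.T₁ (c ⊗ₜ d)) = H.T₁ ((a * c) ⊗ₜ d) := by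
  apply H.of_injective
  rw [← H.mul_of, T₁_spec, T₁_spec, map_mul, mul_assoc]

theorem comul_left_tmul (a q d : A) :
    (H.comul a).left (q ⊗ₜ d) = (tmulOne q).right (H.T₁ (a ⊗ₜ d)) := by
  apply H.of_injective
  rw [← H.mul_of, ← H.of_mul, T₁_spec, ← oneTmul_mul_tmulOne, mul_assoc]

theorem T₁_tmul_mul (a c d : A) :
    H.T₁ (a ⊗ₜ (c * d)) = (oneTmul d).right (H.T₁ (a ⊗ₜ c)) := by
  apply H.of_injective
  rw [← H.of_mul, T₁_spec, T₁_spec, oneTmul_mul, mul_assoc]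

theorem T₂_oneTmul (a p q : A) :
    (oneTmul q).right (H.T₂ (a ⊗ₜ p)) = (tmulOne a).left (H.T₁ (p ⊗ₜ q)) := by
  apply H.of_injective
  rw [← H.of_mul, ← H.mul_of, T₁_spec, T₂_spec, mul_assoc]

/-- The element `Δ(p)(q ⊗ 1)` of `A ⊗ A`. -/
def T₄ (p q : A) : A ⊗[ℂ] A := star (H.T₂ (star q ⊗ₜ star p))

theorem T₄_spec (p q : A) : Multipliers.of (H.T₄ p q) = H.comul p * tmulOne q := by
  rw [T₄, ← star_of, T₂_spec, star_mult_mul, star_tmulOne, ← map_star, star_star, star_star]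

theorem T₄_oneTmul (p q b : A) :
    (oneTmul b).right (H.T₄ p q) = (H.comul p).left (q ⊗ₜ b) := by
  apply H.of_injective
  rw [← H.of_mul, ← H.mul_of, T₄_spec, mul_assoc, tmulOne_mul_oneTmul]

theorem exists_counit : ∃ ε : A →ₗ[ℂ] ℂ, H.IsCounit ε := by
  rcases subsingleton_or_nontrivial A with hA | hA
  · exact ⟨0, fun _ _ => Subsingleton.elim _ _, fun _ _ => Subsingleton.elim _ _⟩
  let E : A ⊗[ℂ] A →ₗ[ℂ] A := LinearMap.mul' ℂ A ∘ₗ H.T₁.symm.toLinearMap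
  have hE : ∀ z, E (H.T₁ z) = LinearMap.mul' ℂ A z := fun z => by simp [E]
  -- `F c (x ⊗ y) = x ⊗ E (y ⊗ c)`
  let F : A → (A ⊗[ℂ] A →ₗ[ℂ] A ⊗[ℂ] A) := fun c =>
    (E ∘ₗ (TensorProduct.mk ℂ A A).flip c).lTensor A
  have h1 : ∀ (c : A) (w : A ⊗[ℂ] A), F c w =
      E.lTensor A (TensorProduct.assoc ℂ A A A (w ⊗ₜ c)) := by
    intro c w
    induction w with
    | zero => simp
    | add x y hx hy => simp only [map_add, TensorProduct.add_tmul, hx, hy]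
    | tmul p q => simp [F]
  have h2 : ∀ (w : A ⊗[ℂ] (A ⊗[ℂ] A)), E.lTensor A (H.T₁.toLinearMap.lTensor A w) =
      (LinearMap.mul' ℂ A).lTensor A w := by
    intro w
    induction w with
    | zero => simp
    | add x y hx hy => simp only [map_add, hx, hy]
    | tmul p q => simp [hE]
  have h3 : ∀ (a : A) (z : A ⊗[ℂ] A), (LinearMap.mul' ℂ A).lTensor A
      (TensorProduct.assoc ℂ A A A (H.T₂.toLinearMap.rTensor A
        ((TensorProduct.assoc ℂ A A A).symm (a ⊗ₜ z)))) = (tmulOne a).left (H.T₁ z) := by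
    intro a z
    induction z with
    | zero => simp
    | add x y hx hy => simp only [map_add, TensorProduct.tmul_add, hx, hy]
    | tmul p q =>
      rw [← T₂_oneTmul]
      simp only [TensorProduct.assoc_symm_tmul, LinearMap.rTensor_tmul]
      change _ = TensorProduct.map LinearMap.id (LinearMap.mulRight ℂ q) _
      generalize (H.T₂.toLinearMap (a ⊗ₜ p)) = u
      induction u with
      | zero => simp
      | add x y hx hy => simp only [map_add, TensorProduct.add_tmul, hx, hy]
      | tmul r s => simp
  have h4 : ∀ (a : A) (z : A ⊗[ℂ] A),
      H.T₂.toLinearMap.rTensor A ((TensorProduct.assoc ℂ A A A).symm (a ⊗ₜ H.T₁ z)) =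
      (TensorProduct.assoc ℂ A A A).symm
        (H.T₁.toLinearMap.lTensor A (TensorProduct.assoc ℂ A A A
          (H.T₂.toLinearMap.rTensor A ((TensorProduct.assoc ℂ A A A).symm (a ⊗ₜ z))))) := by
    intro a z
    induction z with
    | zero => simp
    | add x y hx hy => simp only [map_add, TensorProduct.tmul_add, hx, hy]
    | tmul p q => rw [H.coassoc]; simp
  have h5 : ∀ (a b c : A), F c (H.T₂ (a ⊗ₜ b)) = (a * b) ⊗ₜ c := by
    intro a b c
    have := h4 a (H.T₁.symm (b ⊗ₜ c))
    have := congrArg (fun u => E.lTensor A (TensorProduct.assoc ℂ A A A u)) this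
    simp only [LinearEquiv.apply_symm_apply, h2, h3] at this
    rw [h1]
    simpa [tmulOne, Multipliers.mk, Multipliers.left] using this
  have h6 : ∀ (c : A) (w : A ⊗[ℂ] A), F c w = LinearMap.mul' ℂ A (H.T₂.symm w) ⊗ₜ c := by
    intro c w
    obtain ⟨u, rfl⟩ := H.T₂.surjective w
    rw [LinearEquiv.symm_apply_apply]
    induction u with
    | zero => simp
    | add x y hx hy => simp only [map_add, TensorProduct.add_tmul, hx, hy]
    | tmul p q => simp [h5]
  obtain ⟨x, hx⟩ := exists_ne (0 : A)
  obtain ⟨ω, hω⟩ := Module.Projective.exists_dual_ne_zero ℂ hx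
  let ε : A →ₗ[ℂ] ℂ := (ω x)⁻¹ • (ω ∘ₗ LinearMap.mul' ℂ A ∘ₗ H.T₂.symm.toLinearMap ∘ₗ
    TensorProduct.mk ℂ A A x)
  have hεE : ∀ y c, E (y ⊗ₜ c) = ε y • c := by
    intro y c
    have := congrArg (sliceLeft ω) (h6 c (x ⊗ₜ y))
    simp only [F, LinearMap.lTensor_tmul, sliceLeft_tmul, LinearMap.comp_apply,
      LinearMap.flip_apply, TensorProduct.mk_apply] at this
    simp only [ε, LinearMap.smul_apply, LinearMap.comp_apply, TensorProduct.mk_apply,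
      LinearEquiv.coe_coe, smul_eq_mul, mul_smul, ← this]
    rw [smul_smul, inv_mul_cancel₀ hω, one_smul]
  have hεE' : sliceLeft ε = E := by
    apply TensorProduct.ext'
    intro y c
    rw [hεE, sliceLeft_tmul]
  refine ⟨ε, fun a b => by rw [hεE', hE, LinearMap.mul'_apply], fun a b => ?_⟩
  have h7 : ∀ w, F x w = sliceRight ε w ⊗ₜ x := by
    intro w
    induction w with
    | zero => simp
    | add u v hu hv => simp only [map_add, TensorProduct.add_tmul, hu, hv]
    | tmul p q => simp [F, hεE, TensorProduct.smul_tmul]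
  have h8 := h5 a b x
  rw [h7] at h8
  have h9 := congrArg (sliceRight ω) h8
  simp only [sliceRight_tmul] at h9
  exact smul_right_injective A hω h9

theorem counit_unique {ε ε' : A →ₗ[ℂ] ℂ} (h : H.IsCounit ε) (h' : H.IsCounit ε') : ε = ε' := by
  rcases subsingleton_or_nontrivial A with hA | hA
  · ext a
    rw [Subsingleton.elim a 0, map_zero, map_zero]
  have h1 : sliceLeft ε ∘ₗ H.T₁.toLinearMap = sliceLeft ε' ∘ₗ H.T₁.toLinearMap :=
    TensorProduct.ext' fun a b => by simp [h.1, h'.1]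
  obtain ⟨x, hx⟩ := exists_ne (0 : A)
  ext a
  have h2 := LinearMap.congr_fun h1 (H.T₁.symm (a ⊗ₜ x))
  simp only [LinearMap.comp_apply, LinearEquiv.coe_coe, LinearEquiv.apply_symm_apply,
    sliceLeft_tmul] at h2
  exact smul_left_injective ℂ hx h2

/-- The counit `ε` of `(A, Δ)`: the unique counit. -/
def counit : A →ₗ[ℂ] ℂ := Classical.choose H.exists_counit

theorem isCounit_counit : H.IsCounit H.counit := Classical.choose_spec H.exists_counit

theorem sliceLeft_counit_T₁ (z : A ⊗[ℂ] A) :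
    sliceLeft H.counit (H.T₁ z) = LinearMap.mul' ℂ A z := by
  induction z with
  | zero => simp
  | add x y hx hy => simp [hx, hy]
  | tmul p q => simp [H.isCounit_counit.1]

theorem sliceRight_counit_T₂ (z : A ⊗[ℂ] A) :
    sliceRight H.counit (H.T₂ z) = LinearMap.mul' ℂ A z := by
  induction z with
  | zero => simp
  | add x y hx hy => simp [hx, hy]
  | tmul p q => simp [H.isCounit_counit.2]

theorem counit_mul (a b : A) : H.counit (a * b) = H.counit a * H.counit b := by
  rcases subsingleton_or_nontrivial A with hA | hA
  · simp [Subsingleton.elim b 0]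
  have h1 : ∀ (a : A) (x : A ⊗[ℂ] A),
      sliceLeft H.counit ((H.comul a).left x) = a * sliceLeft H.counit x := by
    intro a x
    obtain ⟨u, rfl⟩ := H.T₁.surjective x
    induction u with
    | zero => simp
    | add x y hx hy => simp only [map_add, mul_add, hx, hy]
    | tmul p q => simp [comul_left_T₁, sliceLeft_counit_T₁, mul_assoc]
  have h2 : ∀ (q : A) (y : A ⊗[ℂ] A),
      sliceLeft H.counit ((tmulOne q).right y) = H.counit q • sliceLeft H.counit y := by
    intro q y
    obtain ⟨u, rfl⟩ := H.T₁.surjective y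
    induction u with
    | zero => simp
    | add x y hx hy => simp only [map_add, smul_add, hx, hy]
    | tmul c d =>
      rw [← comul_left_tmul, h1, sliceLeft_counit_T₁, sliceLeft_tmul, LinearMap.mul'_apply,
        mul_smul_comm]
  obtain ⟨r, hr⟩ := exists_ne (0 : A)
  have h3 := h2 b (a ⊗ₜ r)
  change sliceLeft H.counit (TensorProduct.map _ _ (a ⊗ₜ r)) = _ at h3
  simp only [TensorProduct.map_tmul, LinearMap.mulRight_apply, LinearMap.id_apply, sliceLeft_tmul,
    smul_smul] at h3
  rw [smul_left_injective ℂ hr h3, mul_comm]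

theorem exists_counit_eq_one [Nontrivial A] : ∃ p, H.counit p = 1 := by
  by_contra hcon
  have h0 : H.counit = 0 := by
    ext p
    by_contra hp
    exact hcon ⟨(H.counit p)⁻¹ • p, by simpa using inv_mul_cancel₀ hp⟩
  obtain ⟨x, hx⟩ := exists_ne (0 : A)
  apply hx
  apply H.nondegenerate.1
  intro y
  have := H.isCounit_counit.1 x y
  rw [← this, h0]
  simp [sliceLeft]

/-- `S` is an antipode: with `m` the product of `A`,
`m(S ⊗ ι)(Δ(a)(1 ⊗ b)) = ε(a)b` and `m(ι ⊗ S)((a ⊗ 1)Δ(b)) = ε(b)a`. -/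
def IsAntipode (S : A →ₗ[ℂ] A) : Prop :=
  (∀ a b : A, LinearMap.mul' ℂ A (S.rTensor A (H.T₁ (a ⊗ₜ b))) = H.counit a • b) ∧
    ∀ a b : A, LinearMap.mul' ℂ A (S.lTensor A (H.T₂ (a ⊗ₜ b))) = H.counit b • a

theorem exists_antipode : ∃ S : A →ₗ[ℂ] A, H.IsAntipode S := by
  rcases subsingleton_or_nontrivial A with hA | hA
  · exact ⟨0, fun _ _ => Subsingleton.elim _ _, fun _ _ => Subsingleton.elim _ _⟩
  -- `s (a ⊗ b) = S(a) b`
  let s : A ⊗[ℂ] A →ₗ[ℂ] A := sliceLeft H.counit ∘ₗ H.T₁.symm.toLinearMap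
  have hs : ∀ z, s (H.T₁ z) = sliceLeft H.counit z := fun z => by simp [s]
  have hsR : ∀ (d : A) (z : A ⊗[ℂ] A), s ((oneTmul d).right z) = s z * d := by
    intro d z
    obtain ⟨u, rfl⟩ := H.T₁.surjective z
    induction u with
    | zero => simp
    | add x y hx hy => simp only [map_add, add_mul, hx, hy]
    | tmul p q => rw [← T₁_tmul_mul, hs, hs]; simp [smul_mul_assoc]
  have hsL : ∀ (p : A) (z : A ⊗[ℂ] A), s ((H.comul p).left z) = H.counit p • s z := by
    intro p z
    obtain ⟨u, rfl⟩ := H.T₁.surjective z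
    induction u with
    | zero => simp
    | add x y hx hy => simp only [map_add, smul_add, hx, hy]
    | tmul c d => rw [comul_left_T₁, hs, hs]; simp [counit_mul, mul_smul]
  obtain ⟨p, hp⟩ := H.exists_counit_eq_one
  let S : A →ₗ[ℂ] A :=
    { toFun := fun q => s (H.T₄ p q)
      map_add' := fun q q' => by simp [T₄, TensorProduct.add_tmul]
      map_smul' := fun r q => by
        simp only [T₄, star_smul, ← TensorProduct.smul_tmul', map_smul, star_star,
          RingHom.id_apply] }
  have hS : ∀ q b, S q * b = s (q ⊗ₜ b) := by
    intro q b
    change s (H.T₄ p q) * b = _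
    rw [← hsR, T₄_oneTmul, hsL, hp, one_smul]
  have hS' : ∀ z, LinearMap.mul' ℂ A (S.rTensor A z) = s z := by
    intro z
    induction z with
    | zero => simp
    | add x y hx hy => simp only [map_add, hx, hy]
    | tmul c d => simp [hS]
  refine ⟨S, fun a b => by rw [hS', hs, sliceLeft_tmul], fun a b => ?_⟩
  -- the second identity follows from the first one and coassociativity
  let G : A ⊗[ℂ] (A ⊗[ℂ] A) →ₗ[ℂ] A := LinearMap.mul' ℂ A ∘ₗ s.lTensor A
  have h1 : ∀ (w : A ⊗[ℂ] A) (c : A), G (TensorProduct.assoc ℂ A A A (w ⊗ₜ c)) =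
      LinearMap.mul' ℂ A (S.lTensor A w) * c := by
    intro w c
    induction w with
    | zero => simp
    | add x y hx hy => simp only [map_add, TensorProduct.add_tmul, add_mul, hx, hy]
    | tmul x y => simp [G, ← hS, mul_assoc]
  have h2 : ∀ (w : A ⊗[ℂ] A) (c : A), G (H.T₁.toLinearMap.lTensor A
      (TensorProduct.assoc ℂ A A A (w ⊗ₜ c))) = sliceRight H.counit w * c := by
    intro w c
    induction w with
    | zero => simp
    | add x y hx hy => simp only [map_add, TensorProduct.add_tmul, add_mul, hx, hy]
    | tmul x y => simp [G, hs, smul_mul_assoc]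
  have h3 : ∀ (z : A ⊗[ℂ] A), G (TensorProduct.assoc ℂ A A A
      (H.T₂.toLinearMap.rTensor A ((TensorProduct.assoc ℂ A A A).symm (a ⊗ₜ H.T₁ z)))) =
      a * LinearMap.mul' ℂ A z := by
    intro z
    induction z with
    | zero => simp
    | add x y hx hy => simp only [map_add, TensorProduct.tmul_add, mul_add, hx, hy]
    | tmul x y =>
      rw [H.coassoc, LinearEquiv.apply_symm_apply, h2, sliceRight_counit_T₂]
      simp [mul_assoc]
  rw [← sub_eq_zero]
  apply H.nondegenerate.1
  intro c
  have h4 := h3 (H.T₁.symm (b ⊗ₜ c))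
  simp only [LinearEquiv.apply_symm_apply, TensorProduct.assoc_symm_tmul, LinearMap.rTensor_tmul,
    LinearEquiv.coe_coe, h1] at h4
  rw [sub_mul, h4, ← sliceLeft_counit_T₁, LinearEquiv.apply_symm_apply]
  simp [mul_smul_comm, smul_mul_assoc]

theorem antipode_unique {S S' : A →ₗ[ℂ] A} (h : H.IsAntipode S) (h' : H.IsAntipode S') :
    S = S' := by
  have h1 : LinearMap.mul' ℂ A ∘ₗ S.rTensor A ∘ₗ H.T₁.toLinearMap =
      LinearMap.mul' ℂ A ∘ₗ S'.rTensor A ∘ₗ H.T₁.toLinearMap :=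
    TensorProduct.ext' fun a b => by simp [h.1, h'.1]
  ext a
  rw [← sub_eq_zero]
  apply H.nondegenerate.1
  intro b
  have h2 := LinearMap.congr_fun h1 (H.T₁.symm (a ⊗ₜ b))
  simp only [LinearMap.comp_apply, LinearEquiv.coe_coe, LinearEquiv.apply_symm_apply,
    LinearMap.rTensor_tmul, LinearMap.mul'_apply] at h2
  rw [sub_mul, h2, sub_self]

/-- The antipode `S` of `(A, Δ)`: the unique antipode. -/
def antipode : A →ₗ[ℂ] A := Classical.choose H.exists_antipode

theorem isAntipode_antipode : H.IsAntipode H.antipode := Classical.choose_spec H.exists_antipode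

/-- A left integral: a non-zero linear functional `φ` with `(ι ⊗ φ)Δ(a) = φ(a)1` in `M(A)` for all
`a`, that is, `(ι ⊗ φ)((b ⊗ 1)Δ(a)) = φ(a)b` for all `a` and `b`. -/
def IsLeftIntegral (φ : A →ₗ[ℂ] ℂ) : Prop :=
  φ ≠ 0 ∧ ∀ a b : A, sliceRight φ (H.T₂ (b ⊗ₜ a)) = φ a • b

/-- A right integral: a non-zero linear functional `ψ` with `(ψ ⊗ ι)Δ(a) = ψ(a)1` in `M(A)` for all
`a`, that is, `(ψ ⊗ ι)(Δ(a)(1 ⊗ b)) = ψ(a)b` for all `a` and `b`. -/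
def IsRightIntegral (ψ : A →ₗ[ℂ] ℂ) : Prop :=
  ψ ≠ 0 ∧ ∀ a b : A, sliceLeft ψ (H.T₁ (a ⊗ₜ b)) = ψ a • b

/-- `τ` is a scaling constant for the linear functional `φ`: `φ ∘ S² = τφ`. -/
def IsScalingConstant (φ : A →ₗ[ℂ] ℂ) (τ : ℂ) : Prop :=
  ∀ a : A, φ (H.antipode (H.antipode a)) = τ * φ a

end MultiplierHopfStarAlgebra

open scoped ComplexOrder in
/-- A positive linear functional on a `⋆`-algebra: `ω(a⋆a) ≥ 0` (real and non-negative). -/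
def IsPositiveFunctional {A : Type*} [NonUnitalRing A] [Module ℂ A] [StarRing A]
    (ω : A →ₗ[ℂ] ℂ) : Prop :=
  ∀ a : A, 0 ≤ ω (star a * a)

end VanDaele

end

noncomputable section

namespace VanDaele

namespace MultiplierHopfStarAlgebra

variable {A : Type*} [NonUnitalRing A] [Module ℂ A] [IsScalarTower ℂ A A] [SMulCommClass ℂ A A]
  [StarRing A] [StarModule ℂ A] (H : MultiplierHopfStarAlgebra A)

/-! Let `φ` be a positive left integral with `φ ∘ S² = τφ`, let `σ` be its modular automorphism,
`φ(ax) = φ(xσ(a))`, and put `κ = σS⁻²`. Then `κ` is multiplicative and `φ ∘ κ = τ⁻¹φ`. Positivity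
makes `φ` hermitian, whence `κ(κ(a)⋆) = a⋆`. Strong left invariance, used twice, gives the central
identity `(ι ⊗ κ)Δ(a) = Δ(κ(a))` (`twisted_lTensor_T₁`).

Slicing with the counit yields `ε(κⁿ(d))κⁿ(a) = (ι ⊗ εκⁿ)(Δ(a)(1 ⊗ d))`, which lies in the
finite-dimensional space of first legs of one fixed tensor. For `d = (φ ⊗ ι)((x⋆ ⊗ 1)Δ(x))` the
coefficient `ε(κ²ⁿ(d)) = φ(x⋆κ²ⁿ(x)) = τ⁻ⁿφ(κⁿ(x)⋆κⁿ(x))` never vanishes, by positivity and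
faithfulness. So the orbit of `x` under `κ` spans a finite-dimensional space, and `κ` has an
eigenvector `a`.

Then `e = a⋆a` is an eigenvector too. Its eigenvalue is `τ⁻¹` because `φ(e) ≠ 0`; but `e²` has
eigenvalue `τ⁻²`, and `φ(e²) = φ(e⋆e) ≠ 0` forces this to be `τ⁻¹` again. Hence `τ = 1`.

The general theory required is that `S` is bijective and reverses products and coproducts, and that
left integrals are faithful, unique up to a scalar and have the modular property. Uniqueness carries
the result to every left integral. A positive right integral becomes a positive left integral on the
opposite algebra with the opposite coproduct (`opCop`), which has the same antipode. -/

/-! ### Slices and one-sided multiplications -/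

@[simp] theorem tmulOne_left_tmul (a x y : A) :
    (tmulOne a).left (x ⊗ₜ[ℂ] y) = (a * x) ⊗ₜ y := rfl

@[simp] theorem tmulOne_right_tmul (a x y : A) :
    (tmulOne a).right (x ⊗ₜ[ℂ] y) = (x * a) ⊗ₜ y := rfl

@[simp] theorem oneTmul_left_tmul (a x y : A) :
    (oneTmul a).left (x ⊗ₜ[ℂ] y) = x ⊗ₜ (a * y) := rfl

@[simp] theorem oneTmul_right_tmul (a x y : A) :
    (oneTmul a).right (x ⊗ₜ[ℂ] y) = x ⊗ₜ (y * a) := rfl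

theorem tmulOne_mul_oneTmul_left (a b : A) (z : A ⊗[ℂ] A) :
    (tmulOne a).left ((oneTmul b).left z) = (a ⊗ₜ b) * z := by
  induction z with
  | zero => simp
  | add x y hx hy => simp only [map_add, mul_add, hx, hy]
  | tmul p q => simp

theorem tmulOne_mul_oneTmul_right (a b : A) (z : A ⊗[ℂ] A) :
    (tmulOne a).right ((oneTmul b).right z) = z * (a ⊗ₜ b) := by
  induction z with
  | zero => simp
  | add x y hx hy => simp only [map_add, add_mul, hx, hy]
  | tmul p q => simp

theorem sliceRight_tmulOne_left (ω : A →ₗ[ℂ] ℂ) (a : A) (z : A ⊗[ℂ] A) :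
    sliceRight ω ((tmulOne a).left z) = a * sliceRight ω z := by
  induction z with
  | zero => simp
  | add x y hx hy => simp only [map_add, mul_add, hx, hy]
  | tmul p q => simp [mul_smul_comm]

theorem sliceRight_tmulOne_right (ω : A →ₗ[ℂ] ℂ) (a : A) (z : A ⊗[ℂ] A) :
    sliceRight ω ((tmulOne a).right z) = sliceRight ω z * a := by
  induction z with
  | zero => simp
  | add x y hx hy => simp only [map_add, add_mul, hx, hy]
  | tmul p q => simp [smul_mul_assoc]

theorem sliceLeft_oneTmul_left (ω : A →ₗ[ℂ] ℂ) (a : A) (z : A ⊗[ℂ] A) :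
    sliceLeft ω ((oneTmul a).left z) = a * sliceLeft ω z := by
  induction z with
  | zero => simp
  | add x y hx hy => simp only [map_add, mul_add, hx, hy]
  | tmul p q => simp [mul_smul_comm]

theorem sliceLeft_oneTmul_right (ω : A →ₗ[ℂ] ℂ) (a : A) (z : A ⊗[ℂ] A) :
    sliceLeft ω ((oneTmul a).right z) = sliceLeft ω z * a := by
  induction z with
  | zero => simp
  | add x y hx hy => simp only [map_add, add_mul, hx, hy]
  | tmul p q => simp [smul_mul_assoc]

theorem sliceRight_oneTmul_left (ω : A →ₗ[ℂ] ℂ) (a : A) (z : A ⊗[ℂ] A) :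
    sliceRight ω ((oneTmul a).left z) = sliceRight (ω ∘ₗ LinearMap.mulLeft ℂ a) z := by
  induction z with
  | zero => simp
  | add x y hx hy => simp only [map_add, hx, hy]
  | tmul p q => simp

theorem sliceRight_oneTmul_right (ω : A →ₗ[ℂ] ℂ) (a : A) (z : A ⊗[ℂ] A) :
    sliceRight ω ((oneTmul a).right z) = sliceRight (ω ∘ₗ LinearMap.mulRight ℂ a) z := by
  induction z with
  | zero => simp
  | add x y hx hy => simp only [map_add, hx, hy]
  | tmul p q => simp

theorem sliceLeft_tmulOne_right (ω : A →ₗ[ℂ] ℂ) (a : A) (z : A ⊗[ℂ] A) :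
    sliceLeft ω ((tmulOne a).right z) = sliceLeft (ω ∘ₗ LinearMap.mulRight ℂ a) z := by
  induction z with
  | zero => simp
  | add x y hx hy => simp only [map_add, hx, hy]
  | tmul p q => simp

/-- Slicing both legs, in either order. -/
theorem apply_sliceLeft_eq (ψ φ : A →ₗ[ℂ] ℂ) (z : A ⊗[ℂ] A) :
    φ (sliceLeft ψ z) = ψ (sliceRight φ z) := by
  induction z with
  | zero => simp
  | add x y hx hy => simp only [map_add, hx, hy]
  | tmul p q => simp [mul_comm]

theorem sliceRight_comp (ω : A →ₗ[ℂ] ℂ) (f : A →ₗ[ℂ] A) (z : A ⊗[ℂ] A) :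
    sliceRight (ω ∘ₗ f) z = sliceRight ω (f.lTensor A z) := by
  induction z with
  | zero => simp
  | add x y hx hy => simp only [map_add, hx, hy]
  | tmul p q => simp

theorem apply_sliceRight (ω : A →ₗ[ℂ] ℂ) (f : A →ₗ[ℂ] A) (z : A ⊗[ℂ] A) :
    f (sliceRight ω z) = sliceRight ω (f.rTensor A z) := by
  induction z with
  | zero => simp
  | add x y hx hy => simp only [map_add, hx, hy]
  | tmul p q => simp

theorem apply_sliceLeft (ω : A →ₗ[ℂ] ℂ) (f : A →ₗ[ℂ] A) (z : A ⊗[ℂ] A) :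
    f (sliceLeft ω z) = sliceLeft ω (f.lTensor A z) := by
  induction z with
  | zero => simp
  | add x y hx hy => simp only [map_add, hx, hy]
  | tmul p q => simp


/-! ### Cancellation in `A` and in `A ⊗ A` -/

theorem eq_of_mul_left (H : MultiplierHopfStarAlgebra A) {x y : A} (h : ∀ c, c * x = c * y) :
    x = y := by
  rw [← sub_eq_zero]
  exact H.nondegenerate.2 _ fun c => by rw [mul_sub, h, sub_self]

theorem eq_of_mul_right (H : MultiplierHopfStarAlgebra A) {x y : A} (h : ∀ c, x * c = y * c) :
    x = y := by
  rw [← sub_eq_zero]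
  exact H.nondegenerate.1 _ fun c => by rw [sub_mul, h, sub_self]

theorem tmulOne_oneTmul_right_comm (a b : A) (z : A ⊗[ℂ] A) :
    (tmulOne a).right ((oneTmul b).right z) = (oneTmul b).right ((tmulOne a).right z) := by
  induction z with
  | zero => simp
  | add x y hx hy => simp only [map_add, hx, hy]
  | tmul p q => simp

theorem tmulOne_oneTmul_left_comm (a b : A) (z : A ⊗[ℂ] A) :
    (tmulOne a).left ((oneTmul b).left z) = (oneTmul b).left ((tmulOne a).left z) := by
  induction z with
  | zero => simp
  | add x y hx hy => simp only [map_add, hx, hy]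
  | tmul p q => simp

theorem eq_of_oneTmul_right (H : MultiplierHopfStarAlgebra A) {x y : A ⊗[ℂ] A}
    (h : ∀ c, (oneTmul c).right x = (oneTmul c).right y) : x = y := by
  apply H.tensor_ext
  intro z
  induction z with
  | zero => simp
  | add u v hu hv => rw [mul_add, mul_add, hu, hv]
  | tmul p q => rw [← tmulOne_mul_oneTmul_right, h, tmulOne_mul_oneTmul_right]

theorem eq_of_tmulOne_right (H : MultiplierHopfStarAlgebra A) {x y : A ⊗[ℂ] A}
    (h : ∀ c, (tmulOne c).right x = (tmulOne c).right y) : x = y := by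
  apply H.tensor_ext
  intro z
  induction z with
  | zero => simp
  | add u v hu hv => rw [mul_add, mul_add, hu, hv]
  | tmul p q =>
    rw [← tmulOne_mul_oneTmul_right, tmulOne_oneTmul_right_comm, h, ← tmulOne_oneTmul_right_comm,
      tmulOne_mul_oneTmul_right]

theorem eq_of_tmulOne_left (H : MultiplierHopfStarAlgebra A) {x y : A ⊗[ℂ] A}
    (h : ∀ c, (tmulOne c).left x = (tmulOne c).left y) : x = y := by
  apply H.tensor_ext'
  intro z
  induction z with
  | zero => simp
  | add u v hu hv => rw [add_mul, add_mul, hu, hv]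
  | tmul p q =>
    rw [← tmulOne_mul_oneTmul_left, tmulOne_oneTmul_left_comm, h, ← tmulOne_oneTmul_left_comm,
      tmulOne_mul_oneTmul_left]

/-- The element `(1 ⊗ b)Δ(a)` of `A ⊗ A`. -/
def T₃ (a b : A) : A ⊗[ℂ] A := star (H.T₁ (star a ⊗ₜ star b))

theorem star_oneTmul (a : A) : star (oneTmul a) = oneTmul (star a) := by
  apply multipliers_ext
  · intro x
    change star (TensorProduct.map LinearMap.id (LinearMap.mulRight ℂ a) (star x)) =
      TensorProduct.map LinearMap.id (LinearMap.mulLeft ℂ (star a)) x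
    induction x with
    | zero => simp
    | add x y hx hy => rw [star_add, map_add, star_add, hx, hy, map_add]
    | tmul p q => simp
  · intro x
    change star (TensorProduct.map LinearMap.id (LinearMap.mulLeft ℂ a) (star x)) =
      TensorProduct.map LinearMap.id (LinearMap.mulRight ℂ (star a)) x
    induction x with
    | zero => simp
    | add x y hx hy => rw [star_add, map_add, star_add, hx, hy, map_add]
    | tmul p q => simp

theorem T₃_spec (a b : A) : Multipliers.of (H.T₃ a b) = oneTmul b * H.comul a := by
  rw [T₃, ← star_of, T₁_spec, star_mult_mul, star_oneTmul, ← map_star, star_star, star_star]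

/-! ### Relations between the four canonical maps -/

theorem tmulOne_left_T₁ (a b c : A) :
    (tmulOne c).left (H.T₁ (a ⊗ₜ b)) = (oneTmul b).right (H.T₂ (c ⊗ₜ a)) :=
  (H.T₂_oneTmul c a b).symm

theorem oneTmul_left_T₄ (a b c : A) :
    (oneTmul c).left (H.T₄ a b) = (tmulOne b).right (H.T₃ a c) := by
  apply H.of_injective
  rw [← H.of_mul, ← H.mul_of, T₄_spec, T₃_spec, mul_assoc]

theorem tmulOne_left_T₄ (a b c : A) :
    (tmulOne c).left (H.T₄ a b) = (tmulOne b).right (H.T₂ (c ⊗ₜ a)) := by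
  apply H.of_injective
  rw [← H.of_mul, ← H.mul_of, T₄_spec, T₂_spec, mul_assoc]

theorem oneTmul_left_T₁ (a b c : A) :
    (oneTmul c).left (H.T₁ (a ⊗ₜ b)) = (oneTmul b).right (H.T₃ a c) := by
  apply H.of_injective
  rw [← H.of_mul, ← H.mul_of, T₁_spec, T₃_spec, mul_assoc]

theorem oneTmul_right_T₄ (a b c : A) :
    (oneTmul c).right (H.T₄ a b) = (tmulOne b).right (H.T₁ (a ⊗ₜ c)) := by
  rw [T₄_oneTmul, comul_left_tmul]

theorem oneTmul_left_T₂ (a b c : A) :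
    (oneTmul c).left (H.T₂ (b ⊗ₜ a)) = (tmulOne b).left (H.T₃ a c) := by
  apply H.of_injective
  rw [← H.mul_of, ← H.mul_of, T₂_spec, T₃_spec, ← mul_assoc, ← mul_assoc, tmulOne_mul_oneTmul,
    oneTmul_mul_tmulOne]

/-- The elements `Δ(a)(b ⊗ 1)` span `A ⊗ A`, because the involution carries them to the range of the
surjective `T₂`. -/
theorem T₄_induction {P : A ⊗[ℂ] A → Prop} (h0 : P 0) (hadd : ∀ x y, P x → P y → P (x + y))
    (h : ∀ a b, P (H.T₄ a b)) (z : A ⊗[ℂ] A) : P z := by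
  obtain ⟨u, hu⟩ := H.T₂.surjective (star z)
  have : ∀ u, P (star (H.T₂ u)) := by
    intro u
    induction u with
    | zero => simpa using h0
    | add x y hx hy => simpa only [map_add, star_add] using hadd _ _ hx hy
    | tmul p q => simpa [T₄] using h (star q) (star p)
  simpa [hu] using this u

theorem T₃_induction {P : A ⊗[ℂ] A → Prop} (h0 : P 0) (hadd : ∀ x y, P x → P y → P (x + y))
    (h : ∀ a b, P (H.T₃ a b)) (z : A ⊗[ℂ] A) : P z := by
  obtain ⟨u, hu⟩ := H.T₁.surjective (star z)
  have : ∀ u, P (star (H.T₁ u)) := by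
    intro u
    induction u with
    | zero => simpa using h0
    | add x y hx hy => simpa only [map_add, star_add] using hadd _ _ hx hy
    | tmul p q => simpa [T₃] using h (star p) (star q)
  simpa [hu] using this u

/-! ### Consequences of the counit -/

/-- Take `ε(p) = 1` and write `p ⊗ a = T₁(u)`; applying `ε ⊗ ι` turns this into `a = m(u)`. -/
theorem exists_mul' (H : MultiplierHopfStarAlgebra A) (a : A) :
    ∃ u, LinearMap.mul' ℂ A u = a := by
  rcases subsingleton_or_nontrivial A with hA | hA
  · exact ⟨0, Subsingleton.elim _ _⟩
  obtain ⟨p, hp⟩ := H.exists_counit_eq_one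
  refine ⟨H.T₁.symm (p ⊗ₜ a), ?_⟩
  rw [← sliceLeft_counit_T₁, LinearEquiv.apply_symm_apply, sliceLeft_tmul, hp, one_smul]

/-- `A` is spanned by products. -/
theorem linearMap_ext_mul (H : MultiplierHopfStarAlgebra A) {f g : A →ₗ[ℂ] ℂ}
    (h : ∀ a b, f (a * b) = g (a * b)) : f = g := by
  ext a
  obtain ⟨u, rfl⟩ := H.exists_mul' a
  induction u with
  | zero => simp
  | add x y hx hy => simp only [map_add, hx, hy]
  | tmul p q => exact h p q

theorem sliceRight_counit_T₁ (a b : A) :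
    sliceRight H.counit (H.T₁ (a ⊗ₜ b)) = H.counit b • a := by
  apply H.eq_of_mul_left
  intro c
  have h : H.counit ∘ₗ LinearMap.mulRight ℂ b = H.counit b • H.counit := by
    ext x; simp [counit_mul, mul_comm]
  have h' : ∀ z : A ⊗[ℂ] A, sliceRight (H.counit b • H.counit) z =
      H.counit b • sliceRight H.counit z := by
    intro z
    induction z with
    | zero => simp
    | add x y hx hy => simp only [map_add, smul_add, hx, hy]
    | tmul p q => simp [mul_smul]
  rw [← sliceRight_tmulOne_left, tmulOne_left_T₁, sliceRight_oneTmul_right, h, h',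
    H.isCounit_counit.2, mul_smul_comm]

theorem sliceRight_counit_T₄ (a b : A) : sliceRight H.counit (H.T₄ a b) = a * b := by
  apply H.eq_of_mul_left
  intro c
  rw [← sliceRight_tmulOne_left, tmulOne_left_T₄, sliceRight_tmulOne_right, H.isCounit_counit.2,
    mul_assoc]

/-! ### The antipode -/

theorem mul'_antipode_rTensor_T₁ (z : A ⊗[ℂ] A) :
    LinearMap.mul' ℂ A (H.antipode.rTensor A (H.T₁ z)) = sliceLeft H.counit z := by
  induction z with
  | zero => simp
  | add x y hx hy => simp only [map_add, hx, hy]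
  | tmul p q => rw [H.isAntipode_antipode.1, sliceLeft_tmul]

theorem mul'_antipode_lTensor_T₂ (z : A ⊗[ℂ] A) :
    LinearMap.mul' ℂ A (H.antipode.lTensor A (H.T₂ z)) = sliceRight H.counit z := by
  induction z with
  | zero => simp
  | add x y hx hy => simp only [map_add, hx, hy]
  | tmul p q => rw [H.isAntipode_antipode.2, sliceRight_tmul]

/-- On `z = T₁(c ⊗ d)`, multiplication by `Δ(p)` replaces `c` by `pc`, and `m(S ⊗ ι)T₁ = ε ⊗ ι` with
`ε` multiplicative. Anti-multiplicativity of `S` is not presupposed; it is deduced from this. -/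
theorem mul'_antipode_rTensor_comul (p : A) (z : A ⊗[ℂ] A) :
    LinearMap.mul' ℂ A (H.antipode.rTensor A ((H.comul p).left z)) =
      H.counit p • LinearMap.mul' ℂ A (H.antipode.rTensor A z) := by
  obtain ⟨u, rfl⟩ := H.T₁.surjective z
  induction u with
  | zero => simp
  | add x y hx hy => simp only [map_add, smul_add, hx, hy]
  | tmul c d =>
    rw [comul_left_T₁, mul'_antipode_rTensor_T₁, mul'_antipode_rTensor_T₁]
    simp [counit_mul, mul_smul]

/-- Since `T₁(p ⊗ d)(b ⊗ 1) = Δ(p)(b ⊗ d)`, applying `m(S ⊗ ι)` gives `ε(p)S(b)d`, so right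
multiplication by `b` in the first leg becomes left multiplication by `S(b)`. -/
theorem antipode_mul (a b : A) : H.antipode (a * b) = H.antipode b * H.antipode a := by
  apply H.eq_of_mul_right
  intro c
  have key : ∀ z : A ⊗[ℂ] A, LinearMap.mul' ℂ A (H.antipode.rTensor A ((tmulOne b).right z)) =
      H.antipode b * LinearMap.mul' ℂ A (H.antipode.rTensor A z) := by
    intro z
    obtain ⟨u, rfl⟩ := H.T₁.surjective z
    induction u with
    | zero => simp
    | add x y hx hy => simp only [map_add, mul_add, hx, hy]
    | tmul p d =>
      rw [← comul_left_tmul, mul'_antipode_rTensor_comul, mul'_antipode_rTensor_T₁]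
      simp [mul_smul_comm]
  simpa [mul_assoc] using key (a ⊗ₜ c)

theorem mul'_antipode_rTensor_T₄ (p q : A) :
    LinearMap.mul' ℂ A (H.antipode.rTensor A (H.T₄ p q)) = H.counit p • H.antipode q := by
  apply H.eq_of_mul_right
  intro c
  have h : ∀ z : A ⊗[ℂ] A, LinearMap.mul' ℂ A (H.antipode.rTensor A z) * c =
      LinearMap.mul' ℂ A (H.antipode.rTensor A ((oneTmul c).right z)) := by
    intro z
    induction z with
    | zero => simp
    | add x y hx hy => simp only [map_add, add_mul, hx, hy]
    | tmul p q => simp [mul_assoc]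
  rw [h, T₄_oneTmul, mul'_antipode_rTensor_comul]
  simp [smul_mul_assoc]

/-- The involution exchanges the two one-sided forms of `Δ`, so the conjugate functional satisfies
the counit identity on `T₂`, which determines it. -/
theorem counit_star (a : A) : H.counit (star a) = star (H.counit a) := by
  let ε' : A →ₗ[ℂ] ℂ :=
    { toFun := fun a => star (H.counit (star a))
      map_add' := fun x y => by simp
      map_smul' := fun r x => by simp }
  have hs : ∀ z : A ⊗[ℂ] A, sliceRight ε' z = star (sliceRight H.counit (star z)) := by
    intro z
    induction z with
    | zero => simp
    | add x y hx hy => simp only [map_add, star_add, hx, hy]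
    | tmul p q => simp [ε']
  have h : ∀ a b, sliceRight ε' (H.T₂ (a ⊗ₜ b)) = a * b := by
    intro a b
    rw [hs, ← star_star a, ← star_star b, ← T₄, sliceRight_counit_T₄]
    simp
  rcases subsingleton_or_nontrivial A with hA | hA
  · simp [Subsingleton.elim a 0]
  obtain ⟨x, hx⟩ := exists_ne (0 : A)
  have h1 : sliceRight ε' ∘ₗ H.T₂.toLinearMap = sliceRight H.counit ∘ₗ H.T₂.toLinearMap :=
    TensorProduct.ext' fun a b => by simp [h, sliceRight_counit_T₂]
  have h2 := LinearMap.congr_fun h1 (H.T₂.symm (x ⊗ₜ a))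
  simp only [LinearMap.comp_apply, LinearEquiv.coe_coe, LinearEquiv.apply_symm_apply,
    sliceRight_tmul] at h2
  have h3 := congrArg star (smul_left_injective ℂ hx h2)
  simpa [ε'] using h3

/-- The inverse of the antipode. -/
def antipodeInv : A →ₗ[ℂ] A := starConj H.antipode

theorem antipodeInv_apply (a : A) : H.antipodeInv a = star (H.antipode (star a)) := rfl

theorem mul'_antipodeInv_comm_T₄ (p q : A) :
    LinearMap.mul' ℂ A (H.antipodeInv.rTensor A (TensorProduct.comm ℂ A A (H.T₄ p q))) =
      H.counit p • q := by
  have h : ∀ z : A ⊗[ℂ] A, LinearMap.mul' ℂ A (H.antipodeInv.rTensor A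
      (TensorProduct.comm ℂ A A z)) = star (LinearMap.mul' ℂ A (H.antipode.lTensor A (star z))) := by
    intro z
    induction z with
    | zero => simp
    | add x y hx hy => simp only [map_add, star_add, hx, hy]
    | tmul p q => simp [antipodeInv_apply]
  rw [h, T₄, star_star, mul'_antipode_lTensor_T₂, sliceRight_tmul]
  simp [counit_star]

theorem antipode_antipodeInv (b : A) : H.antipode (H.antipodeInv b) = b := by
  -- On `Δ(p)(q ⊗ 1)` both sides of `key` below equal `ε(p)S(q)`, and these elements span; evaluate
  -- at `a ⊗ b`.
  have h1 : ∀ a, H.antipode a * H.antipode (H.antipodeInv b) = H.antipode a * b := by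
    intro a
    have key : ∀ z : A ⊗[ℂ] A, H.antipode (LinearMap.mul' ℂ A (H.antipodeInv.rTensor A
        (TensorProduct.comm ℂ A A z))) = LinearMap.mul' ℂ A (H.antipode.rTensor A z) := by
      refine H.T₄_induction (by simp) (fun x y hx hy => by simp only [map_add, hx, hy]) ?_
      intro p q
      rw [mul'_antipodeInv_comm_T₄, mul'_antipode_rTensor_T₄, map_smul]
    simpa [antipode_mul] using key (a ⊗ₜ b)
  apply H.eq_of_mul_left
  intro c
  rcases subsingleton_or_nontrivial A with hA | hA
  · exact Subsingleton.elim _ _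
  obtain ⟨p, hp⟩ := H.exists_counit_eq_one
  have h2 : ∀ z : A ⊗[ℂ] A, LinearMap.mul' ℂ A (H.antipode.lTensor A z) *
      H.antipode (H.antipodeInv b) = LinearMap.mul' ℂ A (H.antipode.lTensor A z) * b := by
    intro z
    induction z with
    | zero => simp
    | add x y hx hy => simp only [map_add, add_mul, hx, hy]
    | tmul x y => simp [mul_assoc, h1]
  -- As `ε(p) = 1`, the antipode identity writes `c` as a sum of products `xS(y)`, so the factor
  -- `S(a)` in `h1` may be replaced by any `c`.
  simpa [mul'_antipode_lTensor_T₂, hp] using h2 (H.T₂ (c ⊗ₜ p))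

theorem antipodeInv_antipode (b : A) : H.antipodeInv (H.antipode b) = b := by
  have h := congrArg star (H.antipode_antipodeInv (star b))
  simpa [antipodeInv_apply] using h

theorem antipodeInv_mul (a b : A) :
    H.antipodeInv (a * b) = H.antipodeInv b * H.antipodeInv a := by
  simp [antipodeInv_apply, antipode_mul]

theorem antipode_injective : Function.Injective H.antipode :=
  Function.LeftInverse.injective H.antipodeInv_antipode

theorem antipode_surjective : Function.Surjective H.antipode :=
  Function.RightInverse.surjective H.antipode_antipodeInv

/-! ### Inverting the canonical maps with `S`; `S` reverses the coproduct -/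

theorem comul_left_T₁' (a : A) (u : A ⊗[ℂ] A) :
    (H.comul a).left (H.T₁ u) = H.T₁ ((tmulOne a).left u) := by
  induction u with
  | zero => simp
  | add x y hx hy => simp only [map_add, hx, hy]
  | tmul p q => simp [comul_left_T₁]

theorem T₁_oneTmul_right (b : A) (u : A ⊗[ℂ] A) :
    H.T₁ ((oneTmul b).right u) = (oneTmul b).right (H.T₁ u) := by
  induction u with
  | zero => simp
  | add x y hx hy => simp only [map_add, hx, hy]
  | tmul p q => simp [T₁_tmul_mul]

theorem comul_right_T₂ (b : A) (u : A ⊗[ℂ] A) :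
    (H.comul b).right (H.T₂ u) = H.T₂ ((oneTmul b).right u) := by
  induction u with
  | zero => simp
  | add x y hx hy => simp only [map_add, hx, hy]
  | tmul p q =>
    apply H.of_injective
    rw [← H.of_mul, oneTmul_right_tmul, T₂_spec, T₂_spec, map_mul, mul_assoc]

theorem tmulOne_mul (a b : A) : tmulOne (a * b) = tmulOne a * tmulOne b := by
  apply multipliers_ext
  · intro x
    change TensorProduct.map _ _ x = TensorProduct.map _ _ (TensorProduct.map _ _ x)
    induction x with
    | zero => simp
    | add x y hx hy => simp only [map_add, hx, hy]
    | tmul p q => simp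
  · intro x
    change TensorProduct.map _ _ x = TensorProduct.map _ _ (TensorProduct.map _ _ x)
    induction x with
    | zero => simp
    | add x y hx hy => simp only [map_add, hx, hy]
    | tmul p q => simp [mul_assoc]

theorem T₂_tmulOne_left (a : A) (u : A ⊗[ℂ] A) :
    H.T₂ ((tmulOne a).left u) = (tmulOne a).left (H.T₂ u) := by
  induction u with
  | zero => simp
  | add x y hx hy => simp only [map_add, hx, hy]
  | tmul p q =>
    apply H.of_injective
    rw [← H.mul_of, tmulOne_left_tmul, T₂_spec, T₂_spec, tmulOne_mul, mul_assoc]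

theorem comul_right_tmul (a p b : A) :
    (H.comul b).right (a ⊗ₜ p) = (tmulOne a).left (H.T₃ b p) := by
  apply H.of_injective
  rw [← H.mul_of, ← H.of_mul, T₃_spec, ← tmulOne_mul_oneTmul, mul_assoc]

/-- `(ι ⊗ S)(T₂(a ⊗ b))(1 ⊗ y) = (a ⊗ 1)T₁⁻¹(b ⊗ y)`. -/
theorem antipode_lTensor_T₂_oneTmul (a b y : A) :
    (oneTmul y).right (H.antipode.lTensor A (H.T₂ (a ⊗ₜ b))) =
      (tmulOne a).left (H.T₁.symm (b ⊗ₜ y)) := by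
  -- Contract both sides of coassociativity with `ι ⊗ m(S ⊗ ι)`: on the side where `T₁` acts last it
  -- collapses to the counit.
  let G : A ⊗[ℂ] (A ⊗[ℂ] A) →ₗ[ℂ] A ⊗[ℂ] A :=
    (LinearMap.mul' ℂ A ∘ₗ H.antipode.rTensor A).lTensor A
  have h1 : ∀ (w : A ⊗[ℂ] A) (y : A), G (TensorProduct.assoc ℂ A A A (w ⊗ₜ y)) =
      (oneTmul y).right (H.antipode.lTensor A w) := by
    intro w y
    induction w with
    | zero => simp
    | add u v hu hv => simp only [map_add, TensorProduct.add_tmul, hu, hv]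
    | tmul p q => simp [G]
  have h2 : ∀ (w : A ⊗[ℂ] A) (q : A), G (H.T₁.toLinearMap.lTensor A
      (TensorProduct.assoc ℂ A A A (w ⊗ₜ q))) = sliceRight H.counit w ⊗ₜ q := by
    intro w q
    induction w with
    | zero => simp
    | add u v hu hv => simp only [map_add, TensorProduct.add_tmul, hu, hv]
    | tmul x y => simp [G, mul'_antipode_rTensor_T₁, TensorProduct.smul_tmul]
  have h3 : ∀ u : A ⊗[ℂ] A, G (TensorProduct.assoc ℂ A A A (H.T₂.toLinearMap.rTensor A
      ((TensorProduct.assoc ℂ A A A).symm (a ⊗ₜ H.T₁ u)))) = (tmulOne a).left u := by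
    intro u
    induction u with
    | zero => simp
    | add u v hu hv => simp only [map_add, TensorProduct.tmul_add, hu, hv]
    | tmul p q =>
      rw [H.coassoc, LinearEquiv.apply_symm_apply, h2, sliceRight_counit_T₂]
      simp
  rw [← h3, LinearEquiv.apply_symm_apply, ← h1]
  simp

/-- `T₁((ι ⊗ S)(T₂(a ⊗ b))) = Δ(a)(b ⊗ 1)`. -/
theorem T₁_antipode_lTensor_T₂ (a b : A) :
    H.T₁ (H.antipode.lTensor A (H.T₂ (a ⊗ₜ b))) = H.T₄ a b := by
  apply H.eq_of_oneTmul_right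
  intro y
  rw [← T₁_oneTmul_right, antipode_lTensor_T₂_oneTmul, ← comul_left_T₁', T₄_oneTmul,
    LinearEquiv.apply_symm_apply]

/-- `T₂((S ⊗ ι)(T₁(a ⊗ b))) = (1 ⊗ a)Δ(b)`. -/
theorem T₂_antipode_rTensor_T₁ (p b : A) :
    H.T₂ (H.antipode.rTensor A (H.T₁ (p ⊗ₜ b))) = H.T₃ b p := by
  -- The mirror contraction `m(ι ⊗ S) ⊗ ι`, which collapses `T₂` to the counit.
  let G : (A ⊗[ℂ] A) ⊗[ℂ] A →ₗ[ℂ] A ⊗[ℂ] A :=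
    (LinearMap.mul' ℂ A ∘ₗ H.antipode.lTensor A).rTensor A
  have h1 : ∀ (w : A ⊗[ℂ] A) (a : A), G ((TensorProduct.assoc ℂ A A A).symm (a ⊗ₜ w)) =
      (tmulOne a).left (H.antipode.rTensor A w) := by
    intro w a
    induction w with
    | zero => simp
    | add u v hu hv => simp only [map_add, TensorProduct.tmul_add, hu, hv]
    | tmul p q => simp [G]
  have h2 : ∀ (w : A ⊗[ℂ] A) (q : A), G (H.T₂.toLinearMap.rTensor A
      ((TensorProduct.assoc ℂ A A A).symm (q ⊗ₜ w))) = q ⊗ₜ sliceLeft H.counit w := by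
    intro w q
    induction w with
    | zero => simp
    | add u v hu hv => simp only [map_add, TensorProduct.tmul_add, hu, hv]
    | tmul x y => simp [G, mul'_antipode_lTensor_T₂, TensorProduct.smul_tmul]
  have h3 : ∀ u : A ⊗[ℂ] A, G ((TensorProduct.assoc ℂ A A A).symm (H.T₁.toLinearMap.lTensor A
      (TensorProduct.assoc ℂ A A A (H.T₂ u ⊗ₜ b)))) = (oneTmul b).right u := by
    intro u
    induction u with
    | zero => simp
    | add u v hu hv => simp only [map_add, TensorProduct.add_tmul, hu, hv]
    | tmul p q =>
      rw [← H.coassoc, h2, sliceLeft_counit_T₁]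
      simp
  apply H.eq_of_tmulOne_left
  intro a
  have h4 := h3 (H.T₂.symm (a ⊗ₜ p))
  rw [LinearEquiv.apply_symm_apply, TensorProduct.assoc_tmul, LinearMap.lTensor_tmul, h1] at h4
  rw [← T₂_tmulOne_left, ← comul_right_tmul]
  rw [← H.T₂.apply_symm_apply (a ⊗ₜ p), comul_right_T₂, ← h4]
  rfl

theorem antipode_lTensor_oneTmul_left (y : A) (z : A ⊗[ℂ] A) :
    H.antipode.lTensor A ((oneTmul y).left z) =
      (oneTmul (H.antipode y)).right (H.antipode.lTensor A z) := by
  induction z with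
  | zero => simp
  | add u v hu hv => simp only [map_add, hu, hv]
  | tmul p q => simp [antipode_mul]

/-- `T₁((ι ⊗ S)((1 ⊗ y)Δ(x))) = x ⊗ S(y)`. -/
theorem T₁_antipode_lTensor_T₃ (x y : A) :
    H.T₁ (H.antipode.lTensor A (H.T₃ x y)) = x ⊗ₜ H.antipode y := by
  have h : H.antipode.lTensor A (H.T₃ x y) = H.T₁.symm (x ⊗ₜ H.antipode y) := by
    apply H.eq_of_tmulOne_left
    intro a
    rw [← antipode_lTensor_T₂_oneTmul, ← antipode_lTensor_oneTmul_left, oneTmul_left_T₂]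
    generalize H.T₃ x y = z
    induction z with
    | zero => simp
    | add u v hu hv => simp only [map_add, hu, hv]
    | tmul p q => simp
  rw [h, LinearEquiv.apply_symm_apply]

/-- `T₂(S ⊗ ι)T₁` sends `p ⊗ q` to `(1 ⊗ p)Δ(q)`, and `T₁(ι ⊗ S)` sends that to `q ⊗ S(p)`. This
computes `Δ(S(b))`. -/
theorem T₁_antipode_lTensor_T₂_antipode_rTensor_T₁ (u : A ⊗[ℂ] A) :
    H.T₁ (H.antipode.lTensor A (H.T₂ (H.antipode.rTensor A (H.T₁ u)))) =
      TensorProduct.comm ℂ A A (H.antipode.rTensor A u) := by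
  induction u with
  | zero => simp
  | add x y hx hy => simp only [map_add, hx, hy]
  | tmul p q => rw [T₂_antipode_rTensor_T₁, T₁_antipode_lTensor_T₃]; simp

/-- `Δ(S(b))(1 ⊗ S(a))` is the flip of `(S ⊗ S)((a ⊗ 1)Δ(b))`. -/
theorem T₁_antipode_tmul_antipode (a b : A) :
    H.T₁ (H.antipode b ⊗ₜ H.antipode a) =
      TensorProduct.comm ℂ A A (TensorProduct.map H.antipode H.antipode (H.T₂ (a ⊗ₜ b))) := by
  apply H.eq_of_tmulOne_right
  intro y
  rw [← oneTmul_right_T₄, ← T₁_antipode_lTensor_T₂]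
  -- With `u = T₁⁻¹(b ⊗ y)` the inner term is `S(b) ⊗ y`, so `Δ(S(b))(y ⊗ 1)` is the flip of `(S ⊗
  -- ι)(u)`.
  have h := H.T₁_antipode_lTensor_T₂_antipode_rTensor_T₁ (H.T₁.symm (b ⊗ₜ y))
  rw [LinearEquiv.apply_symm_apply, LinearMap.rTensor_tmul] at h
  rw [h]
  have h1 : ∀ u : A ⊗[ℂ] A, (oneTmul (H.antipode a)).right
      (TensorProduct.comm ℂ A A (H.antipode.rTensor A u)) =
      TensorProduct.comm ℂ A A (H.antipode.rTensor A ((tmulOne a).left u)) := by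
    intro u
    induction u with
    | zero => simp
    | add x y hx hy => simp only [map_add, hx, hy]
    | tmul p q => simp [antipode_mul]
  rw [h1, ← antipode_lTensor_T₂_oneTmul]
  generalize H.T₂ (a ⊗ₜ b) = z
  induction z with
  | zero => simp
  | add x y hx hy => simp only [map_add, hx, hy]
  | tmul p q => simp

/-- `(S(b) ⊗ 1)Δ(S(a))` is the flip of `(S ⊗ S)(Δ(a)(1 ⊗ b))`. -/
theorem T₂_antipode_tmul_antipode (a b : A) :
    H.T₂ (H.antipode b ⊗ₜ H.antipode a) =
      TensorProduct.comm ℂ A A (TensorProduct.map H.antipode H.antipode (H.T₁ (a ⊗ₜ b))) := by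
  apply H.eq_of_oneTmul_right
  intro c'
  obtain ⟨c, rfl⟩ := H.antipode_surjective c'
  rw [T₂_oneTmul, T₁_antipode_tmul_antipode]
  have h1 : ∀ u : A ⊗[ℂ] A, (tmulOne (H.antipode b)).left (TensorProduct.comm ℂ A A
      (TensorProduct.map H.antipode H.antipode u)) = TensorProduct.comm ℂ A A
      (TensorProduct.map H.antipode H.antipode ((oneTmul b).right u)) := by
    intro u
    induction u with
    | zero => simp
    | add x y hx hy => simp only [map_add, hx, hy]
    | tmul p q => simp [antipode_mul]
  have h2 : ∀ u : A ⊗[ℂ] A, (oneTmul (H.antipode c)).right (TensorProduct.comm ℂ A A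
      (TensorProduct.map H.antipode H.antipode u)) = TensorProduct.comm ℂ A A
      (TensorProduct.map H.antipode H.antipode ((tmulOne c).left u)) := by
    intro u
    induction u with
    | zero => simp
    | add x y hx hy => simp only [map_add, hx, hy]
    | tmul p q => simp [antipode_mul]
  rw [h1, h2, T₂_oneTmul]

variable {H}

/-! ### Integrals: exchange by `S`, strong invariance, faithfulness -/

theorem IsLeftIntegral.comp_antipode {φ : A →ₗ[ℂ] ℂ} (h : H.IsLeftIntegral φ) :
    H.IsRightIntegral (φ ∘ₗ H.antipode) := by
  constructor
  · intro h0
    apply h.1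
    ext a
    obtain ⟨b, rfl⟩ := H.antipode_surjective a
    exact LinearMap.congr_fun h0 b
  · intro a b
    apply H.antipode_injective
    rw [map_smul, LinearMap.comp_apply, ← h.2, T₂_antipode_tmul_antipode]
    generalize H.T₁ (a ⊗ₜ b) = z
    induction z with
    | zero => simp
    | add x y hx hy => simp only [map_add, hx, hy]
    | tmul p q => simp

theorem IsRightIntegral.comp_antipode {ψ : A →ₗ[ℂ] ℂ} (h : H.IsRightIntegral ψ) :
    H.IsLeftIntegral (ψ ∘ₗ H.antipode) := by
  constructor
  · intro h0
    apply h.1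
    ext a
    obtain ⟨b, rfl⟩ := H.antipode_surjective a
    exact LinearMap.congr_fun h0 b
  · intro a b
    apply H.antipode_injective
    rw [map_smul, LinearMap.comp_apply, ← h.2, T₁_antipode_tmul_antipode]
    generalize H.T₂ (b ⊗ₜ a) = z
    induction z with
    | zero => simp
    | add x y hx hy => simp only [map_add, hx, hy]
    | tmul p q => simp

/-- Strong left invariance. -/
theorem IsLeftIntegral.antipode_sliceRight_T₁ {φ : A →ₗ[ℂ] ℂ} (h : H.IsLeftIntegral φ)
    (a b : A) : H.antipode (sliceRight φ (H.T₁ (a ⊗ₜ b))) = sliceRight φ (H.T₃ b a) := by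
  -- Left invariance says that `ι ⊗ φ` absorbs `T₂`; insert `T₂` and use `T₂(S ⊗ ι)T₁(a ⊗ b) = (1 ⊗
  -- a)Δ(b)`.
  have h1 : ∀ z : A ⊗[ℂ] A, sliceRight φ (H.T₂ z) = sliceRight φ z := by
    intro z
    induction z with
    | zero => simp
    | add x y hx hy => simp only [map_add, hx, hy]
    | tmul p q => rw [h.2, sliceRight_tmul]
  rw [apply_sliceRight, ← h1, T₂_antipode_rTensor_T₁]

/-- Strong right invariance. -/
theorem IsRightIntegral.antipode_sliceLeft_T₂ {ψ : A →ₗ[ℂ] ℂ} (h : H.IsRightIntegral ψ)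
    (a b : A) : H.antipode (sliceLeft ψ (H.T₂ (a ⊗ₜ b))) = sliceLeft ψ (H.T₄ a b) := by
  have h1 : ∀ z : A ⊗[ℂ] A, sliceLeft ψ (H.T₁ z) = sliceLeft ψ z := by
    intro z
    induction z with
    | zero => simp
    | add x y hx hy => simp only [map_add, hx, hy]
    | tmul p q => rw [h.2, sliceLeft_tmul]
  rw [apply_sliceLeft, ← h1, T₁_antipode_lTensor_T₂]

/-- If the slices of `z` by the functionals `φ(x · )` vanish, then `z` belongs to `A ⊗ N`, where
`N` is the common kernel of these functionals. -/
theorem apply_eq_zero_of_sliceRight {V : Type*} [AddCommGroup V] [Module ℂ V] (φ : A →ₗ[ℂ] ℂ)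
    (z : A ⊗[ℂ] A) (hz : ∀ x, sliceRight (φ ∘ₗ LinearMap.mulLeft ℂ x) z = 0)
    (F : A ⊗[ℂ] A →ₗ[ℂ] V) (hF : ∀ p q, (∀ x, φ (x * q) = 0) → F (p ⊗ₜ q) = 0) : F z = 0 := by
  let b := Module.Free.chooseBasis ℂ A
  obtain ⟨c, rfl⟩ := TensorProduct.eq_repr_basis_left b z
  -- The second-leg coefficients in a basis of the first leg are slices of `z`; since slices on
  -- different legs commute, they all lie in `N`.
  have hc : ∀ j, sliceLeft (b.coord j) (c.sum fun i n => b i ⊗ₜ[ℂ] n) = c j := by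
    intro j
    rw [map_finsuppSum]
    simp only [sliceLeft_tmul, Module.Basis.coord_apply, Module.Basis.repr_self]
    rw [Finsupp.sum, Finset.sum_eq_single j]
    · simp
    · intro i _ hij
      simp [hij]
    · intro hj
      simp [Finsupp.notMem_support_iff.1 hj]
  rw [map_finsuppSum]
  refine Finset.sum_eq_zero fun j _ => hF _ _ fun x => ?_
  have h := apply_sliceLeft_eq (b.coord j) (φ ∘ₗ LinearMap.mulLeft ℂ x)
    (c.sum fun i n => b i ⊗ₜ[ℂ] n)
  rw [hc, hz, map_zero] at h
  exact h

/-- Strong invariance rewrites `(ι ⊗ φ)((1 ⊗ x)Δ(n))` as `S((ι ⊗ φ)(Δ(x)(1 ⊗ n)))`, where `φ( · n) =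
0` applies. So `Δ(n)(y ⊗ 1)` lies in `A ⊗ N`, with `N` the kernel to be shown trivial. -/
theorem IsLeftIntegral.sliceRight_T₄_eq_zero {φ : A →ₗ[ℂ] ℂ} (h : H.IsLeftIntegral φ) {n : A}
    (hn : ∀ x, φ (x * n) = 0) (x y : A) :
    sliceRight (φ ∘ₗ LinearMap.mulLeft ℂ x) (H.T₄ n y) = 0 := by
  have h0 : φ ∘ₗ LinearMap.mulRight ℂ n = 0 := by
    ext x; simpa using hn x
  have h1 : sliceRight φ (H.T₁ (x ⊗ₜ n)) = 0 := by
    apply H.eq_of_mul_left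
    intro c
    rw [← sliceRight_tmulOne_left, tmulOne_left_T₁, sliceRight_oneTmul_right, h0]
    simp [sliceRight]
  rw [← sliceRight_oneTmul_left, oneTmul_left_T₄, sliceRight_tmulOne_right,
    ← h.antipode_sliceRight_T₁, h1]
  simp

/-- A left integral is faithful. -/
theorem IsLeftIntegral.eq_zero_of_forall {φ : A →ₗ[ℂ] ℂ} (h : H.IsLeftIntegral φ) {n : A}
    (hn : ∀ x, φ (x * n) = 0) : n = 0 := by
  -- If `ε` kills `N`, then `ι ⊗ ε` kills `Δ(n)(y ⊗ 1)`, so `ny = 0` for all `y`.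
  by_cases hε : ∀ n, (∀ x, φ (x * n) = 0) → H.counit n = 0
  · apply H.nondegenerate.1
    intro y
    rw [← sliceRight_counit_T₄]
    refine apply_eq_zero_of_sliceRight φ _ (fun x => h.sliceRight_T₄_eq_zero hn x y) _ ?_
    intro p q hq
    rw [sliceRight_tmul, hε q hq, zero_smul]
  -- Otherwise some `m` in `N` has `ε(m) ≠ 0`. Applying `φ(x · )m(S ⊗ ι)` to `Δ(m)(y ⊗ 1)` gives
  -- `ε(m)φ(xS(y)) = 0`, so `φ = 0` as `A` is spanned by products.
  · push Not at hε
    obtain ⟨m, hm, hm'⟩ := hε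
    exfalso
    apply h.1
    apply H.linearMap_ext_mul
    intro x y
    obtain ⟨y, rfl⟩ := H.antipode_surjective y
    have h1 := apply_eq_zero_of_sliceRight φ _ (fun x => h.sliceRight_T₄_eq_zero hm x y)
      (φ ∘ₗ LinearMap.mulLeft ℂ x ∘ₗ LinearMap.mul' ℂ A ∘ₗ H.antipode.rTensor A) (by
        intro p q hq
        simpa [mul_assoc] using hq (x * H.antipode p))
    simp only [LinearMap.comp_apply, mul'_antipode_rTensor_T₄, map_smul,
      LinearMap.mulLeft_apply, smul_eq_mul, mul_eq_zero, hm', false_or] at h1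
    simpa using h1

theorem IsLeftIntegral.eq_of_forall {φ : A →ₗ[ℂ] ℂ} (h : H.IsLeftIntegral φ) {m n : A}
    (hn : ∀ x, φ (x * m) = φ (x * n)) : m = n := by
  rw [← sub_eq_zero]
  exact h.eq_zero_of_forall fun x => by rw [mul_sub, map_sub, hn, sub_self]

/-! ### Comparison of left and right integrals; modularity and uniqueness -/

/-- Both sides equal `(ψ ⊗ φ)((b ⊗ 1)Δ(x)(1 ⊗ c))`, sliced in the two possible orders and rewritten
by strong invariance on either leg. -/
theorem integral_mul_right_eq {φ ψ : A →ₗ[ℂ] ℂ} (hφ : H.IsLeftIntegral φ)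
    (hψ : H.IsRightIntegral ψ) (b c x : A) :
    φ (x * sliceLeft (ψ ∘ₗ H.antipodeInv) (H.T₄ c (H.antipode b))) =
      ψ (sliceRight (φ ∘ₗ H.antipodeInv) (H.T₃ b (H.antipode c)) * x) := by
  have h1 : φ (x * sliceLeft (ψ ∘ₗ H.antipodeInv) (H.T₄ c (H.antipode b))) =
      ψ (b * sliceRight φ (H.T₁ (x ⊗ₜ c))) := by
    change (φ ∘ₗ LinearMap.mulLeft ℂ x) _ = _
    rw [apply_sliceLeft_eq, ← sliceRight_oneTmul_left, oneTmul_left_T₄, sliceRight_tmulOne_right,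
      ← hφ.antipode_sliceRight_T₁, ← antipode_mul, LinearMap.comp_apply, antipodeInv_antipode]
  have h2 : ψ (sliceRight (φ ∘ₗ H.antipodeInv) (H.T₃ b (H.antipode c)) * x) =
      φ (sliceLeft ψ (H.T₂ (b ⊗ₜ x)) * c) := by
    change (ψ ∘ₗ LinearMap.mulRight ℂ x) _ = _
    rw [← apply_sliceLeft_eq, ← sliceLeft_tmulOne_right, ← oneTmul_left_T₄,
      sliceLeft_oneTmul_left, ← hψ.antipode_sliceLeft_T₂, ← antipode_mul, LinearMap.comp_apply,
      antipodeInv_antipode]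
  rw [h1, h2, ← sliceRight_tmulOne_left, tmulOne_left_T₁, ← apply_sliceLeft_eq,
    sliceLeft_oneTmul_right]

/-- Here the common value is `(ψ ⊗ φ)((S(b) ⊗ c)Δ(x))`. -/
theorem integral_mul_left_eq {φ ψ : A →ₗ[ℂ] ℂ} (hφ : H.IsLeftIntegral φ)
    (hψ : H.IsRightIntegral ψ) (b c x : A) :
    φ (sliceLeft (ψ ∘ₗ H.antipode) (H.T₄ c b) * x) =
      ψ (sliceRight (φ ∘ₗ H.antipodeInv) (H.T₁ (H.antipode b ⊗ₜ H.antipode c)) * x) := by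
  have h1 : φ (sliceLeft (ψ ∘ₗ H.antipode) (H.T₄ c b) * x) =
      ψ (H.antipode b * sliceRight φ (H.T₃ x c)) := by
    change (φ ∘ₗ LinearMap.mulRight ℂ x) _ = _
    rw [apply_sliceLeft_eq, ← sliceRight_oneTmul_right, oneTmul_right_T₄, sliceRight_tmulOne_right,
      ← hφ.antipode_sliceRight_T₁, ← antipode_mul, LinearMap.comp_apply]
  have h2 : ψ (sliceRight (φ ∘ₗ H.antipodeInv) (H.T₁ (H.antipode b ⊗ₜ H.antipode c)) * x) =
      φ (c * sliceLeft ψ (H.T₂ (H.antipode b ⊗ₜ x))) := by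
    change (ψ ∘ₗ LinearMap.mulRight ℂ x) _ = _
    rw [← apply_sliceLeft_eq, ← sliceLeft_tmulOne_right, ← oneTmul_right_T₄,
      sliceLeft_oneTmul_right, ← hψ.antipode_sliceLeft_T₂, ← antipode_mul, LinearMap.comp_apply,
      antipodeInv_antipode]
  rw [h1, h2, ← sliceRight_tmulOne_left, ← oneTmul_left_T₂, ← sliceLeft_oneTmul_left,
    apply_sliceLeft_eq]

theorem exists_sliceLeft_eq {ω : A →ₗ[ℂ] ℂ} (hω : ω ≠ 0) (a : A) : ∃ z, sliceLeft ω z = a := by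
  obtain ⟨p, hp⟩ : ∃ p, ω p ≠ 0 := by
    by_contra! hcon
    exact hω (LinearMap.ext hcon)
  exact ⟨((ω p)⁻¹ • p) ⊗ₜ a, by simp [hp]⟩

theorem exists_sliceRight_eq {ω : A →ₗ[ℂ] ℂ} (hω : ω ≠ 0) (a : A) : ∃ z, sliceRight ω z = a := by
  obtain ⟨p, hp⟩ : ∃ p, ω p ≠ 0 := by
    by_contra! hcon
    exact hω (LinearMap.ext hcon)
  exact ⟨a ⊗ₜ ((ω p)⁻¹ • p), by simp [hp]⟩

theorem comp_antipodeInv_ne_zero {ω : A →ₗ[ℂ] ℂ} (hω : ω ≠ 0) : ω ∘ₗ H.antipodeInv ≠ 0 := by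
  intro h0
  apply hω
  ext a
  simpa [antipodeInv_antipode] using LinearMap.congr_fun h0 (H.antipode a)

theorem comp_antipode_ne_zero {ω : A →ₗ[ℂ] ℂ} (hω : ω ≠ 0) : ω ∘ₗ H.antipode ≠ 0 := by
  intro h0
  apply hω
  ext a
  simpa [antipode_antipodeInv] using LinearMap.congr_fun h0 (H.antipodeInv a)

/-- Every `d` is a combination of the slices in `integral_mul_right_eq`, because `ψ ∘ S⁻¹ ≠ 0` and
the elements `Δ(c)(S(b) ⊗ 1)` span `A ⊗ A`. -/
theorem exists_right_eq_left {φ ψ : A →ₗ[ℂ] ℂ} (hφ : H.IsLeftIntegral φ)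
    (hψ : H.IsRightIntegral ψ) (d : A) : ∃ d', ∀ x, φ (x * d) = ψ (d' * x) := by
  obtain ⟨z, rfl⟩ := exists_sliceLeft_eq (comp_antipodeInv_ne_zero (H := H) hψ.1) d
  refine H.T₄_induction (P := fun z => ∃ d', ∀ x, φ (x * sliceLeft (ψ ∘ₗ H.antipodeInv) z) =
    ψ (d' * x)) ⟨0, by simp⟩ ?_ ?_ z
  · rintro u v ⟨d, hd⟩ ⟨e, he⟩
    exact ⟨d + e, fun x => by simp only [map_add, mul_add, add_mul, hd, he]⟩
  · intro c b
    obtain ⟨b, rfl⟩ := H.antipode_surjective b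
    exact ⟨_, integral_mul_right_eq hφ hψ b c⟩

theorem exists_left_eq_right {φ ψ : A →ₗ[ℂ] ℂ} (hφ : H.IsLeftIntegral φ)
    (hψ : H.IsRightIntegral ψ) (d : A) : ∃ d', ∀ x, ψ (d * x) = φ (x * d') := by
  obtain ⟨z, rfl⟩ := exists_sliceRight_eq (comp_antipodeInv_ne_zero (H := H) hφ.1) d
  refine H.T₃_induction (P := fun z => ∃ d', ∀ x, ψ (sliceRight (φ ∘ₗ H.antipodeInv) z * x) =
    φ (x * d')) ⟨0, by simp⟩ ?_ ?_ z
  · rintro u v ⟨d, hd⟩ ⟨e, he⟩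
    exact ⟨d + e, fun x => by simp only [map_add, mul_add, add_mul, hd, he]⟩
  · intro b c
    obtain ⟨c, rfl⟩ := H.antipode_surjective c
    exact ⟨_, fun x => (integral_mul_right_eq hφ hψ b c x).symm⟩

theorem exists_left_eq_left {φ ψ : A →ₗ[ℂ] ℂ} (hφ : H.IsLeftIntegral φ)
    (hψ : H.IsRightIntegral ψ) (d : A) : ∃ d', ∀ x, φ (d * x) = ψ (d' * x) := by
  obtain ⟨z, rfl⟩ := exists_sliceLeft_eq (comp_antipode_ne_zero (H := H) hψ.1) d
  refine H.T₄_induction (P := fun z => ∃ d', ∀ x, φ (sliceLeft (ψ ∘ₗ H.antipode) z * x) =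
    ψ (d' * x)) ⟨0, by simp⟩ ?_ ?_ z
  · rintro u v ⟨d, hd⟩ ⟨e, he⟩
    exact ⟨d + e, fun x => by simp only [map_add, add_mul, hd, he]⟩
  · intro c b
    exact ⟨_, integral_mul_left_eq hφ hψ b c⟩

/-- The modular property of a left integral. -/
theorem IsLeftIntegral.exists_modular {φ : A →ₗ[ℂ] ℂ} (hφ : H.IsLeftIntegral φ) (a : A) :
    ∃ d, ∀ x, φ (a * x) = φ (x * d) := by
  -- The right integral `φ ∘ S` is the intermediary that moves the factor from one side to the
  -- other.
  obtain ⟨e, he⟩ := exists_left_eq_left hφ hφ.comp_antipode a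
  obtain ⟨d, hd⟩ := exists_left_eq_right hφ hφ.comp_antipode e
  exact ⟨d, fun x => by rw [he, hd]⟩

/-- Right invariance, with a factor on the left. -/
theorem IsRightIntegral.sliceLeft_T₃ {ψ : A →ₗ[ℂ] ℂ} (h : H.IsRightIntegral ψ) (a x : A) :
    sliceLeft ψ (H.T₃ a x) = ψ a • x := by
  apply H.eq_of_mul_right
  intro c
  rw [← sliceLeft_oneTmul_right, ← oneTmul_left_T₁, sliceLeft_oneTmul_left, h.2,
    mul_smul_comm, smul_mul_assoc]

/-- Left integrals are unique up to a scalar. -/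
theorem IsLeftIntegral.exists_eq_smul {φ φ' : A →ₗ[ℂ] ℂ} (h : H.IsLeftIntegral φ)
    (h' : H.IsLeftIntegral φ') : ∃ c : ℂ, φ' = c • φ := by
  have hψ := h.comp_antipode
  set ψ := φ ∘ₗ H.antipode
  obtain ⟨a, ha⟩ : ∃ a, ψ a ≠ 0 := by
    by_contra! hcon
    exact hψ.1 (LinearMap.ext hcon)
  obtain ⟨d, hd⟩ := exists_right_eq_left h' hψ a
  obtain ⟨e, he⟩ := exists_left_eq_right h hψ d
  have h1 : φ' ∘ₗ LinearMap.mulRight ℂ a = φ ∘ₗ LinearMap.mulRight ℂ e := by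
    ext x
    simp [hd, he]
  have h2 : ∀ x, sliceRight φ' (H.T₁ (x ⊗ₜ a)) = sliceRight φ (H.T₁ (x ⊗ₜ e)) := by
    intro x
    apply H.eq_of_mul_left
    intro c
    rw [← sliceRight_tmulOne_left, tmulOne_left_T₁, sliceRight_oneTmul_right, h1,
      ← sliceRight_oneTmul_right, ← tmulOne_left_T₁, sliceRight_tmulOne_left]
  have h3 : ∀ x, ψ a * φ' x = ψ e * φ x := by
    intro x
    -- Strong invariance turns `S` of the two slices into slices of `(1 ⊗ x)Δ(a)` and `(1 ⊗ x)Δ(e)`;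
    -- applying `ψ` to the first leg leaves `ψ(a)x` and `ψ(e)x`.
    have h4 := congrArg (fun y => ψ (H.antipode y)) (h2 x)
    simp only [h.antipode_sliceRight_T₁, h'.antipode_sliceRight_T₁, ← apply_sliceLeft_eq,
      hψ.sliceLeft_T₃, map_smul, smul_eq_mul] at h4
    exact h4
  refine ⟨(ψ a)⁻¹ * ψ e, LinearMap.ext fun x => ?_⟩
  rw [LinearMap.smul_apply, smul_eq_mul, mul_assoc, ← h3, inv_mul_cancel_left₀ ha]

/-- The scaling constant exists. -/
theorem IsLeftIntegral.exists_isScalingConstant {φ : A →ₗ[ℂ] ℂ} (h : H.IsLeftIntegral φ) :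
    ∃ τ : ℂ, τ ≠ 0 ∧ H.IsScalingConstant φ τ := by
  obtain ⟨τ, hτ⟩ := h.exists_eq_smul h.comp_antipode.comp_antipode
  refine ⟨τ, ?_, fun a => LinearMap.congr_fun hτ a⟩
  rintro rfl
  exact h.comp_antipode.comp_antipode.1 (by rw [hτ, zero_smul])

/-! ### Positive functionals -/

theorem _root_.VanDaele.IsPositiveFunctional.map_star_mul {φ : A →ₗ[ℂ] ℂ}
    (hφ : IsPositiveFunctional φ) (x y : A) : φ (star y * x) = star (φ (star x * y)) := by
  have him : ∀ a, (φ (star a * a)).im = 0 := fun a => ((Complex.le_def.1 (hφ a)).2).symm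
  have h1 := him (x + y)
  have h2 := him (x + Complex.I • y)
  simp only [star_add, add_mul, mul_add, map_add, star_smul, smul_mul_assoc, mul_smul_comm,
    map_smul, Complex.add_im, him, smul_eq_mul, Complex.mul_im, Complex.mul_re, Complex.I_re,
    Complex.I_im, RCLike.star_def, Complex.conj_re, Complex.conj_im] at h1 h2
  apply Complex.ext
  · simp only [RCLike.star_def, Complex.conj_re]
    linarith
  · simp only [RCLike.star_def, Complex.conj_im]
    linarith

/-- The degenerate case of the Cauchy–Schwarz inequality. -/
theorem _root_.VanDaele.IsPositiveFunctional.map_mul_eq_zero {φ : A →ₗ[ℂ] ℂ}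
    (hφ : IsPositiveFunctional φ) {a : A} (ha : φ (star a * a) = 0) (x : A) : φ (x * a) = 0 := by
  obtain ⟨y, rfl⟩ := star_involutive.surjective x
  by_contra hc
  set c := φ (star y * a) with hcdef
  have hpos : 0 < Complex.normSq c := Complex.normSq_pos.2 hc
  -- This size makes the form at `y - s c̄ a` equal to `φ(y⋆y) - 2(φ(y⋆y) + 1)`, which is negative.
  let s : ℝ := ((φ (star y * y)).re + 1) / Complex.normSq c
  have h := (Complex.le_def.1 (hφ (y + (-(s : ℂ) * star c) • a))).1
  simp only [star_add, add_mul, mul_add, map_add, star_smul, smul_mul_assoc, mul_smul_comm,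
    map_smul, smul_eq_mul, ha, hφ.map_star_mul y a, ← hcdef, mul_zero, add_zero] at h
  have e1 : (-(s : ℂ) * star c) * c = ((-(s * Complex.normSq c) : ℝ) : ℂ) := by
    rw [mul_assoc, RCLike.star_def, ← Complex.normSq_eq_conj_mul_self]
    push_cast; ring
  have e2 : star (-(s : ℂ) * star c) * star c = ((-(s * Complex.normSq c) : ℝ) : ℂ) := by
    rw [← star_mul', e1, RCLike.star_def, Complex.conj_ofReal]
  rw [e1, e2] at h
  have e3 : s * Complex.normSq c = (φ (star y * y)).re + 1 := div_mul_cancel₀ _ hpos.ne'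
  rw [e3] at h
  have h0 := (Complex.le_def.1 (hφ y)).1
  simp only [Complex.add_re, Complex.ofReal_re, Complex.zero_re] at h h0
  linarith

variable {φ : A →ₗ[ℂ] ℂ}

theorem map_star_of_isPositiveFunctional (H : MultiplierHopfStarAlgebra A)
    (hφ : IsPositiveFunctional φ) (x : A) : φ (star x) = star (φ x) := by
  obtain ⟨u, rfl⟩ := H.exists_mul' x
  induction u with
  | zero => simp
  | add x y hx hy => simp only [map_add, star_add, hx, hy]
  | tmul p q =>
    have h := hφ.map_star_mul (star p) q
    simpa using h

theorem IsLeftIntegral.map_star_mul_self_ne_zero (h : H.IsLeftIntegral φ)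
    (hφ : IsPositiveFunctional φ) {a : A} (ha : a ≠ 0) : φ (star a * a) ≠ 0 := fun h0 =>
  ha (h.eq_zero_of_forall fun x => hφ.map_mul_eq_zero h0 x)

theorem IsLeftIntegral.tensor_ext (h : H.IsLeftIntegral φ) {y z : A ⊗[ℂ] A}
    (hyz : ∀ x, sliceRight (φ ∘ₗ LinearMap.mulLeft ℂ x) y =
      sliceRight (φ ∘ₗ LinearMap.mulLeft ℂ x) z) : y = z := by
  rw [← sub_eq_zero]
  refine apply_eq_zero_of_sliceRight φ (y - z) (fun x => by rw [map_sub, hyz, sub_self])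
    LinearMap.id fun p q hq => ?_
  rw [h.eq_zero_of_forall hq, TensorProduct.tmul_zero, map_zero]

theorem sliceRight_smul (c : ℂ) (ω : A →ₗ[ℂ] ℂ) (z : A ⊗[ℂ] A) :
    sliceRight (c • ω) z = c • sliceRight ω z := by
  induction z with
  | zero => simp
  | add x y hx hy => simp only [map_add, smul_add, hx, hy]
  | tmul p q => simp [mul_smul]

theorem oneTmul_left_T₃ (H : MultiplierHopfStarAlgebra A) (a b c : A) :
    (oneTmul c).left (H.T₃ a b) = H.T₃ a (c * b) := by
  apply H.of_injective
  rw [← H.mul_of, T₃_spec, T₃_spec, oneTmul_mul, mul_assoc]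

theorem T₁_antipode_sq (H : MultiplierHopfStarAlgebra A) (a b : A) :
    H.T₁ (H.antipode (H.antipode a) ⊗ₜ H.antipode (H.antipode b)) =
      TensorProduct.map (H.antipode ∘ₗ H.antipode) (H.antipode ∘ₗ H.antipode)
        (H.T₁ (a ⊗ₜ b)) := by
  rw [T₁_antipode_tmul_antipode, T₂_antipode_tmul_antipode]
  generalize H.T₁ (a ⊗ₜ b) = z
  induction z with
  | zero => simp
  | add x y hx hy => simp only [map_add, hx, hy]
  | tmul p q => simp

/-- The map `κ = σS⁻²`, where `σ` is the modular automorphism of a left integral. -/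
theorem IsLeftIntegral.exists_twisted_modular (h : H.IsLeftIntegral φ) :
    ∃ κ : A →ₗ[ℂ] A, ∀ a x, φ (x * κ a) = φ (H.antipodeInv (H.antipodeInv a) * x) := by
  -- Faithfulness makes the chosen element unique, hence linear in `a`.
  choose f hf using fun a => h.exists_modular (H.antipodeInv (H.antipodeInv a))
  refine ⟨⟨⟨f, fun a b => ?_⟩, fun r a => ?_⟩, fun a x => (hf a x).symm⟩
  · apply h.eq_of_forall
    intro x
    simp only [mul_add, map_add, ← hf, add_mul]
  · apply h.eq_of_forall
    intro x
    simp only [mul_smul_comm, map_smul, ← hf, smul_mul_assoc, RingHom.id_apply]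

/-! ### The twisted modular map `κ = σS⁻²` -/

section Twisted

variable {τ : ℂ} {κ : A →ₗ[ℂ] A}

theorem IsScalingConstant.map_antipodeInv_sq (hτ : H.IsScalingConstant φ τ) (hτ0 : τ ≠ 0)
    (a : A) : φ (H.antipodeInv (H.antipodeInv a)) = τ⁻¹ * φ a := by
  rw [eq_inv_mul_iff_mul_eq₀ hτ0, ← hτ, antipode_antipodeInv, antipode_antipodeInv]

theorem twisted_map_mul (h : H.IsLeftIntegral φ)
    (hκ : ∀ a x, φ (x * κ a) = φ (H.antipodeInv (H.antipodeInv a) * x)) (a b : A) :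
    κ (a * b) = κ a * κ b := by
  apply h.eq_of_forall
  intro x
  rw [hκ, ← mul_assoc, hκ, ← mul_assoc, hκ, antipodeInv_mul, antipodeInv_mul, mul_assoc]

theorem integral_twisted (h : H.IsLeftIntegral φ) (hτ : H.IsScalingConstant φ τ) (hτ0 : τ ≠ 0)
    (hκ : ∀ a x, φ (x * κ a) = φ (H.antipodeInv (H.antipodeInv a) * x)) (a : A) :
    φ (κ a) = τ⁻¹ * φ a := by
  have h1 : φ ∘ₗ κ = τ⁻¹ • φ := by
    apply H.linearMap_ext_mul
    intro b c
    rw [LinearMap.comp_apply, twisted_map_mul h hκ, hκ, hκ, ← antipodeInv_mul, ← antipodeInv_mul,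
      hτ.map_antipodeInv_sq hτ0]
    rfl
  exact LinearMap.congr_fun h1 a

/-- Scaling by `S²` gives `φ(x⋆S²(κ(a))) = φ(ax⋆)`. Conjugate this, using that `φ` is hermitian and
that `S²(y)⋆ = S⁻²(y⋆)`. -/
theorem twisted_star_twisted (h : H.IsLeftIntegral φ) (hφ : IsPositiveFunctional φ)
    (hτ : H.IsScalingConstant φ τ) (hτ0 : τ ≠ 0)
    (hκ : ∀ a x, φ (x * κ a) = φ (H.antipodeInv (H.antipodeInv a) * x)) (a : A) :
    κ (star (κ a)) = star a := by
  apply h.eq_of_forall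
  intro x
  have h1 : φ (star x * H.antipode (H.antipode (κ a))) = φ (a * star x) := by
    have h2 := hτ.map_antipodeInv_sq hτ0 (star x * H.antipode (H.antipode (κ a)))
    rw [antipodeInv_mul, antipodeInv_mul, antipodeInv_antipode, antipodeInv_antipode, hκ,
      ← antipodeInv_mul, ← antipodeInv_mul, hτ.map_antipodeInv_sq hτ0] at h2
    exact (mul_left_cancel₀ (inv_ne_zero hτ0) h2).symm
  have h3 := congrArg star h1
  rw [← map_star_of_isPositiveFunctional H hφ, ← map_star_of_isPositiveFunctional H hφ] at h3
  rw [hκ]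
  simpa [antipodeInv_apply] using h3

/-- Strong invariance at `κ(a)`, the definition of `κ`, then strong invariance again produce `S²` of
a slice of `Δ(S⁻²(a))(1 ⊗ b)`. As `S²` respects `Δ` and scales `φ`, it can be moved inside at the
cost of `τ⁻¹`. -/
theorem sliceRight_T₃_twisted (h : H.IsLeftIntegral φ) (hτ : H.IsScalingConstant φ τ)
    (hτ0 : τ ≠ 0) (hκ : ∀ a x, φ (x * κ a) = φ (H.antipodeInv (H.antipodeInv a) * x)) (a b : A) :
    sliceRight φ (H.T₃ (κ a) b) =
      τ⁻¹ • sliceRight φ (H.T₁ (a ⊗ₜ H.antipode (H.antipode b))) := by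
  set a' := H.antipodeInv (H.antipodeInv a) with ha'
  have ha : H.antipode (H.antipode a') = a := by
    rw [ha', antipode_antipodeInv, antipode_antipodeInv]
  have h0 : φ ∘ₗ LinearMap.mulRight ℂ (κ a) = φ ∘ₗ LinearMap.mulLeft ℂ a' := by
    ext x
    simpa using hκ a x
  have h1 : sliceRight φ (H.T₁ (b ⊗ₜ κ a)) = sliceRight φ (H.T₃ b a') := by
    apply H.eq_of_mul_left
    intro c
    rw [← sliceRight_tmulOne_left, tmulOne_left_T₁, sliceRight_oneTmul_right, h0,
      ← sliceRight_oneTmul_left, oneTmul_left_T₂, sliceRight_tmulOne_left]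
  rw [← h.antipode_sliceRight_T₁, h1, ← h.antipode_sliceRight_T₁, ← ha, T₁_antipode_sq]
  generalize H.T₁ (a' ⊗ₜ b) = z
  induction z with
  | zero => simp
  | add x y hx hy => simp only [map_add, smul_add, hx, hy]
  | tmul p q => simp [hτ q, smul_smul, hτ0]

/-- By faithfulness it suffices to slice with `φ(b · )`. Both sides become `τ⁻¹(ι ⊗ φ)(Δ(a)(1 ⊗
dS²(b)))`. -/
theorem twisted_lTensor_T₁ (h : H.IsLeftIntegral φ) (hτ : H.IsScalingConstant φ τ)
    (hτ0 : τ ≠ 0) (hκ : ∀ a x, φ (x * κ a) = φ (H.antipodeInv (H.antipodeInv a) * x)) (a d : A) :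
    κ.lTensor A (H.T₁ (a ⊗ₜ d)) = H.T₁ (κ a ⊗ₜ κ d) := by
  apply h.tensor_ext
  intro b
  have h1 : (φ ∘ₗ LinearMap.mulLeft ℂ b) ∘ₗ κ =
      τ⁻¹ • (φ ∘ₗ LinearMap.mulRight ℂ (H.antipode (H.antipode b))) := by
    ext x
    have h2 := hτ.map_antipodeInv_sq hτ0 (x * H.antipode (H.antipode b))
    rw [antipodeInv_mul, antipodeInv_mul, antipodeInv_antipode, antipodeInv_antipode] at h2
    simpa [hκ] using h2
  have h3 : φ ∘ₗ LinearMap.mulRight ℂ (κ d) =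
      φ ∘ₗ LinearMap.mulLeft ℂ (H.antipodeInv (H.antipodeInv d)) := by
    ext x
    simpa using hκ d x
  rw [← sliceRight_comp, h1, sliceRight_smul, ← sliceRight_oneTmul_right, ← T₁_tmul_mul,
    ← sliceRight_oneTmul_left, oneTmul_left_T₁, sliceRight_oneTmul_right, h3,
    ← sliceRight_oneTmul_left, oneTmul_left_T₃, sliceRight_T₃_twisted h hτ hτ0 hκ, antipode_mul,
    antipode_mul, antipode_antipodeInv, antipode_antipodeInv]

theorem twisted_lTensor_T₂ (hκm : ∀ a b, κ (a * b) = κ a * κ b) (hκs : Function.Surjective κ)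
    (hκT : ∀ a d, κ.lTensor A (H.T₁ (a ⊗ₜ d)) = H.T₁ (κ a ⊗ₜ κ d)) (c a : A) :
    κ.lTensor A (H.T₂ (c ⊗ₜ a)) = H.T₂ (c ⊗ₜ κ a) := by
  apply H.eq_of_oneTmul_right
  intro d
  obtain ⟨d, rfl⟩ := hκs d
  have h1 : ∀ z : A ⊗[ℂ] A, (oneTmul (κ d)).right (κ.lTensor A z) =
      κ.lTensor A ((oneTmul d).right z) := by
    intro z
    induction z with
    | zero => simp
    | add x y hx hy => simp only [map_add, hx, hy]
    | tmul p q => simp [hκm]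
  have h2 : ∀ z : A ⊗[ℂ] A, κ.lTensor A ((tmulOne c).left z) =
      (tmulOne c).left (κ.lTensor A z) := by
    intro z
    induction z with
    | zero => simp
    | add x y hx hy => simp only [map_add, hx, hy]
    | tmul p q => simp
  rw [h1, T₂_oneTmul, h2, hκT, ← T₂_oneTmul]

/-! ### Powers of `κ` and an eigenvector -/

theorem sliceRight_counit_comp_pow_T₁
    (hκT : ∀ a d, κ.lTensor A (H.T₁ (a ⊗ₜ d)) = H.T₁ (κ a ⊗ₜ κ d)) (n : ℕ) (a d : A) :
    sliceRight (H.counit ∘ₗ (κ ^ n : Module.End ℂ A)) (H.T₁ (a ⊗ₜ d)) =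
      H.counit ((κ ^ n : Module.End ℂ A) d) • (κ ^ n : Module.End ℂ A) a := by
  induction n generalizing a d with
  | zero => exact H.sliceRight_counit_T₁ a d
  | succ n ih =>
    rw [pow_succ, Module.End.mul_eq_comp, ← LinearMap.comp_assoc, sliceRight_comp, hκT, ih]
    rfl

/-- Each `κ` on the second leg passes into the argument of `Δ`, after which `ε` removes that leg. -/
theorem counit_pow_sliceLeft_T₂ (hκT : ∀ c a, κ.lTensor A (H.T₂ (c ⊗ₜ a)) = H.T₂ (c ⊗ₜ κ a))
    (ω : A →ₗ[ℂ] ℂ) (n : ℕ) (c a : A) :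
    H.counit ((κ ^ n : Module.End ℂ A) (sliceLeft ω (H.T₂ (c ⊗ₜ a)))) =
      ω (c * (κ ^ n : Module.End ℂ A) a) := by
  induction n generalizing a with
  | zero =>
    change H.counit (sliceLeft ω (H.T₂ (c ⊗ₜ a))) = ω (c * a)
    rw [apply_sliceLeft_eq, H.isCounit_counit.2]
  | succ n ih =>
    rw [pow_succ, Module.End.mul_apply, apply_sliceLeft, hκT, ih]
    rfl

/-- Apply `φ ∘ κ = τ⁻¹φ` to `κ(y)⋆κ(x)`: as `κ(κ(y)⋆) = y⋆`, one `κ` moves across the pairing.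
Halving an even power in this way yields an expression that is positive for `x = y`. -/
theorem integral_star_mul_twisted_pow (h : H.IsLeftIntegral φ) (hφ : IsPositiveFunctional φ)
    (hτ : H.IsScalingConstant φ τ) (hτ0 : τ ≠ 0)
    (hκ : ∀ a x, φ (x * κ a) = φ (H.antipodeInv (H.antipodeInv a) * x)) (n : ℕ) (x y : A) :
    φ (star y * (κ ^ (2 * n) : Module.End ℂ A) x) =
      τ⁻¹ ^ n * φ (star ((κ ^ n : Module.End ℂ A) y) * (κ ^ n : Module.End ℂ A) x) := by
  induction n generalizing x y with
  | zero => simp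
  | succ n ih =>
    have h1 : ∀ x y, φ (star y * κ (κ x)) = τ⁻¹ * φ (star (κ y) * κ x) := by
      intro x y
      rw [← integral_twisted h hτ hτ0 hκ, twisted_map_mul h hκ,
        twisted_star_twisted h hφ hτ hτ0 hκ]
    rw [show 2 * (n + 1) = 2 * n + 2 by ring, pow_add, Module.End.mul_apply, ih,
      ← Module.End.mul_apply, ← pow_add, add_comm n 2, pow_add, Module.End.mul_apply,
      show (κ ^ 2 : Module.End ℂ A) ((κ ^ n : Module.End ℂ A) x) =
        κ (κ ((κ ^ n : Module.End ℂ A) x)) from rfl, h1, pow_succ, mul_assoc, pow_succ']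
    rfl

theorem exists_finiteDimensional_sliceRight (z : A ⊗[ℂ] A) :
    ∃ V : Submodule ℂ A, FiniteDimensional ℂ V ∧ ∀ ω, sliceRight ω z ∈ V := by
  induction z with
  | zero => exact ⟨⊥, inferInstance, fun ω => by simp⟩
  | add x y hx hy =>
    obtain ⟨V, hV, hV'⟩ := hx
    obtain ⟨W, hW, hW'⟩ := hy
    refine ⟨V ⊔ W, inferInstance, fun ω => ?_⟩
    rw [map_add]
    exact Submodule.add_mem_sup (hV' ω) (hW' ω)
  | tmul p q =>
    refine ⟨Submodule.span ℂ {p}, inferInstance, fun ω => ?_⟩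
    rw [sliceRight_tmul]
    exact Submodule.smul_mem _ _ (Submodule.mem_span_singleton_self p)

theorem exists_eigenvector_of_even_powers {V : Submodule ℂ A} [FiniteDimensional ℂ V] {x : A}
    (hx : x ≠ 0) (hV : ∀ n, (κ ^ (2 * n) : Module.End ℂ A) x ∈ V) :
    ∃ (a : A) (c : ℂ), a ≠ 0 ∧ κ a = c • a := by
  let W : Submodule ℂ A := Submodule.span ℂ (Set.range fun n => (κ ^ n : Module.End ℂ A) x)
  -- Only even powers are controlled; odd ones lie in the image of `V` under `κ`.
  have hWV : W ≤ V ⊔ V.map κ := by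
    refine Submodule.span_le.2 ?_
    rintro _ ⟨n, rfl⟩
    rcases Nat.even_or_odd' n with ⟨k, rfl | rfl⟩
    · exact Submodule.mem_sup_left (hV k)
    · refine Submodule.mem_sup_right ⟨_, hV k, ?_⟩
      change _ = (κ ^ (2 * k + 1) : Module.End ℂ A) x
      rw [pow_succ', Module.End.mul_apply]
  have : FiniteDimensional ℂ W := Submodule.finiteDimensional_of_le hWV
  have hκW : ∀ w ∈ W, κ w ∈ W := by
    intro w hw
    induction hw using Submodule.span_induction with
    | mem w hw =>
      obtain ⟨n, rfl⟩ := hw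
      refine Submodule.subset_span ⟨n + 1, ?_⟩
      change (κ ^ (n + 1) : Module.End ℂ A) x = _
      rw [pow_succ', Module.End.mul_apply]
    | zero => simp
    | add u v _ _ hu hv => rw [map_add]; exact W.add_mem hu hv
    | smul r u _ hu => rw [map_smul]; exact W.smul_mem r hu
  have hxW : x ∈ W := Submodule.subset_span ⟨0, by simp⟩
  have : Nontrivial W := ⟨⟨⟨x, hxW⟩, 0, fun h0 => hx (congrArg Subtype.val h0)⟩⟩
  obtain ⟨c, hc⟩ := Module.End.exists_eigenvalue (κ.restrict hκW)
  obtain ⟨w, hw⟩ := hc.exists_hasEigenvector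
  refine ⟨w, c, fun h0 => hw.2 (Subtype.ext h0), ?_⟩
  exact congrArg Subtype.val hw.apply_eq_smul

end Twisted

/-- The scaling constant of a positive left integral is `1`. -/
theorem IsScalingConstant.eq_one_of_isPositiveFunctional {τ : ℂ} (hτ : H.IsScalingConstant φ τ)
    (h : H.IsLeftIntegral φ) (hφ : IsPositiveFunctional φ) (hτ0 : τ ≠ 0) : τ = 1 := by
  obtain ⟨κ, hκ⟩ := h.exists_twisted_modular
  have hκm := twisted_map_mul h hκ
  have hκφ := integral_twisted h hτ hτ0 hκ
  have hκstar := twisted_star_twisted h hφ hτ hτ0 hκ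
  have hκinj : ∀ a, κ a = 0 → a = 0 := by
    intro a ha
    have := hκstar a
    rw [ha, star_zero, map_zero] at this
    exact star_eq_zero.1 this.symm
  have hκsurj : Function.Surjective κ := fun a => ⟨star (κ (star a)), by rw [hκstar, star_star]⟩
  have hκT₁ := twisted_lTensor_T₁ h hτ hτ0 hκ
  have hκT₂ := twisted_lTensor_T₂ hκm hκsurj hκT₁
  obtain ⟨x, hx⟩ : ∃ x : A, x ≠ 0 := by
    by_contra! hcon
    exact h.1 (LinearMap.ext fun a => by rw [hcon a, map_zero, map_zero])
  have hpow : ∀ n, (κ ^ n : Module.End ℂ A) x ≠ 0 := by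
    intro n
    induction n with
    | zero => simpa using hx
    | succ n ih =>
      rw [pow_succ', Module.End.mul_apply]
      exact fun h0 => ih (hκinj _ h0)
  -- Chosen so that `ε(κ²ⁿ(b)) = φ(x⋆κ²ⁿ(x))`, a nonzero multiple of `φ(κⁿ(x)⋆κⁿ(x))`.
  set b := sliceLeft φ (H.T₂ (star x ⊗ₜ x))
  have hb : ∀ n, H.counit ((κ ^ (2 * n) : Module.End ℂ A) b) ≠ 0 := by
    intro n
    rw [counit_pow_sliceLeft_T₂ hκT₂, integral_star_mul_twisted_pow h hφ hτ hτ0 hκ]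
    exact mul_ne_zero (pow_ne_zero _ (inv_ne_zero hτ0))
      (h.map_star_mul_self_ne_zero hφ (hpow n))
  obtain ⟨V, hV, hV'⟩ := exists_finiteDimensional_sliceRight (H.T₁ (x ⊗ₜ b))
  obtain ⟨a, c, ha, hac⟩ := exists_eigenvector_of_even_powers (κ := κ) hx (V := V) (by
    intro n
    have h1 := hV' (H.counit ∘ₗ (κ ^ (2 * n) : Module.End ℂ A))
    rw [sliceRight_counit_comp_pow_T₁ hκT₁] at h1
    exact (V.smul_mem_iff (hb n)).1 h1)
  have hc : c ≠ 0 := by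
    rintro rfl
    exact ha (hκinj a (by rw [hac, zero_smul]))
  -- From `κ(κ(a)⋆) = a⋆` with `κ(a) = ca`.
  have hstar : κ (star a) = (star c)⁻¹ • star a := by
    have h1 := hκstar a
    rw [hac, star_smul, map_smul] at h1
    rwa [eq_inv_smul_iff₀ (star_ne_zero.2 hc)]
  set μ := (star c)⁻¹ * c
  have hκe : κ (star a * a) = μ • (star a * a) := by
    rw [hκm, hstar, hac, smul_mul_smul_comm]
  have he := h.map_star_mul_self_ne_zero hφ ha
  set e := star a * a with hedef
  have hμ : μ = τ⁻¹ := by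
    have h1 := hκφ e
    rw [hκe, map_smul, smul_eq_mul] at h1
    exact mul_right_cancel₀ he h1
  -- `e` is self-adjoint and nonzero, so `e² = e⋆e`; comparing the factors for `e` and `e²` gives
  -- `τ⁻² = τ⁻¹`.
  have hee : φ (e * e) ≠ 0 := by
    have h1 := h.map_star_mul_self_ne_zero hφ (a := e) fun h0 => he (by rw [h0, map_zero])
    rwa [hedef, star_mul, star_star, ← hedef] at h1
  have h2 := hκφ (e * e)
  rw [hκm, hκe, smul_mul_smul_comm, map_smul, smul_eq_mul, hμ] at h2
  have h3 := mul_right_cancel₀ hee h2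
  have h4 : τ⁻¹ = 1 := mul_left_cancel₀ (inv_ne_zero hτ0) (by rw [h3, mul_one])
  exact inv_eq_one.1 h4

theorem IsLeftIntegral.isScalingConstant_one (h : H.IsLeftIntegral φ)
    (hφ : IsPositiveFunctional φ) {φ' : A →ₗ[ℂ] ℂ} (h' : H.IsLeftIntegral φ') :
    H.IsScalingConstant φ' 1 := by
  obtain ⟨τ, hτ0, hτ⟩ := h.exists_isScalingConstant
  obtain ⟨c, rfl⟩ := h.exists_eq_smul h'
  rw [hτ.eq_one_of_isPositiveFunctional h hφ hτ0] at hτ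
  intro a
  simp [hτ a]

/-! ### The opposite algebra with the opposite coproduct -/

section OpCop

open MulOpposite

variable (A) in
/-- The anti-isomorphism `op a ⊗ op b ↦ b ⊗ a` from `Aᵒᵖ ⊗ Aᵒᵖ` to `A ⊗ A`. -/
def opFlip : Aᵐᵒᵖ ⊗[ℂ] Aᵐᵒᵖ ≃ₗ[ℂ] A ⊗[ℂ] A :=
  (TensorProduct.congr (opLinearEquiv ℂ).symm (opLinearEquiv ℂ).symm).trans
    (TensorProduct.comm ℂ A A)

@[simp] theorem opFlip_tmul (a b : Aᵐᵒᵖ) : opFlip A (a ⊗ₜ b) = unop b ⊗ₜ unop a := by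
  simp [opFlip]

@[simp] theorem opFlip_symm_tmul (a b : A) : (opFlip A).symm (a ⊗ₜ b) = op b ⊗ₜ op a := by
  rw [LinearEquiv.symm_apply_eq, opFlip_tmul]
  rfl

theorem opFlip_mul (x y : Aᵐᵒᵖ ⊗[ℂ] Aᵐᵒᵖ) : opFlip A (x * y) = opFlip A y * opFlip A x := by
  induction x with
  | zero => simp
  | add u v hu hv => simp only [map_add, add_mul, mul_add, hu, hv]
  | tmul p q =>
    induction y with
    | zero => simp
    | add u v hu hv => simp only [map_add, add_mul, mul_add, hu, hv]
    | tmul r s => simp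

theorem opFlip_star (x : Aᵐᵒᵖ ⊗[ℂ] Aᵐᵒᵖ) : opFlip A (star x) = star (opFlip A x) := by
  induction x with
  | zero => simp
  | add u v hu hv => simp only [map_add, star_add, hu, hv]
  | tmul p q => simp

/-- The anti-isomorphism from `M(A ⊗ A)` to `M(Aᵒᵖ ⊗ Aᵒᵖ)` induced by `opFlip`. -/
def multiplierOpFlip (m : Multipliers (A ⊗[ℂ] A)) : Multipliers (Aᵐᵒᵖ ⊗[ℂ] Aᵐᵒᵖ) :=
  Multipliers.mk ((opFlip A).symm.toLinearMap ∘ₗ m.right ∘ₗ (opFlip A).toLinearMap)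
    ((opFlip A).symm.toLinearMap ∘ₗ m.left ∘ₗ (opFlip A).toLinearMap) (fun x y => by
      apply (opFlip A).injective
      simp [opFlip_mul, m.right_mul_eq])

theorem multiplierOpFlip_left (m : Multipliers (A ⊗[ℂ] A)) (x : Aᵐᵒᵖ ⊗[ℂ] Aᵐᵒᵖ) :
    (multiplierOpFlip m).left x = (opFlip A).symm (m.right (opFlip A x)) := rfl

theorem multiplierOpFlip_right (m : Multipliers (A ⊗[ℂ] A)) (x : Aᵐᵒᵖ ⊗[ℂ] Aᵐᵒᵖ) :
    (multiplierOpFlip m).right x = (opFlip A).symm (m.left (opFlip A x)) := rfl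

theorem multiplierOpFlip_mul (m n : Multipliers (A ⊗[ℂ] A)) :
    multiplierOpFlip (m * n) = multiplierOpFlip n * multiplierOpFlip m := by
  apply multipliers_ext
  · intro x
    change (opFlip A).symm (n.right (m.right _)) =
      (opFlip A).symm (n.right (opFlip A ((opFlip A).symm (m.right _))))
    rw [LinearEquiv.apply_symm_apply]
  · intro x
    change (opFlip A).symm (m.left (n.left _)) =
      (opFlip A).symm (m.left (opFlip A ((opFlip A).symm (n.left _))))
    rw [LinearEquiv.apply_symm_apply]

theorem multiplierOpFlip_of (z : A ⊗[ℂ] A) :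
    multiplierOpFlip (Multipliers.of z) = Multipliers.of ((opFlip A).symm z) := by
  apply multipliers_ext
  · intro x
    change (opFlip A).symm (opFlip A x * z) = (opFlip A).symm z * x
    rw [LinearEquiv.symm_apply_eq, opFlip_mul, LinearEquiv.apply_symm_apply]
  · intro x
    change (opFlip A).symm (z * opFlip A x) = x * (opFlip A).symm z
    rw [LinearEquiv.symm_apply_eq, opFlip_mul, LinearEquiv.apply_symm_apply]

theorem multiplierOpFlip_tmulOne (a : A) :
    multiplierOpFlip (tmulOne a) = oneTmul (op a) := by
  apply multipliers_ext
  · intro x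
    rw [multiplierOpFlip_left]
    induction x with
    | zero => simp
    | add x y hx hy => simp only [map_add, hx, hy]
    | tmul p q => simp
  · intro x
    rw [multiplierOpFlip_right]
    induction x with
    | zero => simp
    | add x y hx hy => simp only [map_add, hx, hy]
    | tmul p q => simp

theorem multiplierOpFlip_oneTmul (a : A) :
    multiplierOpFlip (oneTmul a) = tmulOne (op a) := by
  apply multipliers_ext
  · intro x
    rw [multiplierOpFlip_left]
    induction x with
    | zero => simp
    | add x y hx hy => simp only [map_add, hx, hy]
    | tmul p q => simp
  · intro x
    rw [multiplierOpFlip_right]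
    induction x with
    | zero => simp
    | add x y hx hy => simp only [map_add, hx, hy]
    | tmul p q => simp

theorem multiplierOpFlip_star (m : Multipliers (A ⊗[ℂ] A)) :
    multiplierOpFlip (star m) = star (multiplierOpFlip m) := by
  have h : ∀ z : A ⊗[ℂ] A, (opFlip A).symm (star z) = star ((opFlip A).symm z) := by
    intro z
    rw [LinearEquiv.symm_apply_eq, opFlip_star, LinearEquiv.apply_symm_apply]
  apply multipliers_ext
  · intro x
    change (opFlip A).symm (star (m.left (star (opFlip A x)))) =
      star ((opFlip A).symm (m.left (opFlip A (star x))))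
    rw [h, opFlip_star]
  · intro x
    change (opFlip A).symm (star (m.right (star (opFlip A x)))) =
      star ((opFlip A).symm (m.right (opFlip A (star x))))
    rw [h, opFlip_star]

/-- Reversing all three legs (`J`, `J'`) exchanges `T₁` with `T₂`, hence the two sides of
coassociativity for `A`. -/
theorem opFlip_coassoc (H : MultiplierHopfStarAlgebra A) (a b c : Aᵐᵒᵖ) :
    ((opFlip A).trans (H.T₁.trans (opFlip A).symm)).toLinearMap.rTensor Aᵐᵒᵖ
        ((TensorProduct.assoc ℂ Aᵐᵒᵖ Aᵐᵒᵖ Aᵐᵒᵖ).symm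
          (a ⊗ₜ (opFlip A).symm (H.T₂ (opFlip A (b ⊗ₜ c))))) =
      (TensorProduct.assoc ℂ Aᵐᵒᵖ Aᵐᵒᵖ Aᵐᵒᵖ).symm
        (((opFlip A).trans (H.T₂.trans (opFlip A).symm)).toLinearMap.lTensor Aᵐᵒᵖ
          (TensorProduct.assoc ℂ Aᵐᵒᵖ Aᵐᵒᵖ Aᵐᵒᵖ
            ((opFlip A).symm (H.T₁ (opFlip A (a ⊗ₜ b))) ⊗ₜ c))) := by
  let J : Aᵐᵒᵖ ⊗[ℂ] (Aᵐᵒᵖ ⊗[ℂ] Aᵐᵒᵖ) ≃ₗ[ℂ] (A ⊗[ℂ] A) ⊗[ℂ] A :=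
    (TensorProduct.congr (opLinearEquiv ℂ).symm (opFlip A)).trans (TensorProduct.comm ℂ _ _)
  let J' : (Aᵐᵒᵖ ⊗[ℂ] Aᵐᵒᵖ) ⊗[ℂ] Aᵐᵒᵖ ≃ₗ[ℂ] A ⊗[ℂ] (A ⊗[ℂ] A) :=
    (TensorProduct.congr (opFlip A) (opLinearEquiv ℂ).symm).trans (TensorProduct.comm ℂ _ _)
  have hJ : ∀ x w, J (x ⊗ₜ w) = opFlip A w ⊗ₜ unop x := fun x w => rfl
  have hJ' : ∀ w x, J' (w ⊗ₜ x) = unop x ⊗ₜ opFlip A w := fun w x => rfl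
  have h1 : ∀ w x, J (TensorProduct.assoc ℂ Aᵐᵒᵖ Aᵐᵒᵖ Aᵐᵒᵖ (w ⊗ₜ x)) =
      (TensorProduct.assoc ℂ A A A).symm (J' (w ⊗ₜ x)) := by
    intro w x
    induction w with
    | zero => simp
    | add u v hu hv => simp only [map_add, TensorProduct.add_tmul, hu, hv]
    | tmul p q => simp [hJ, hJ']
  have h2 : ∀ y, J' ((TensorProduct.assoc ℂ Aᵐᵒᵖ Aᵐᵒᵖ Aᵐᵒᵖ).symm y) =
      TensorProduct.assoc ℂ A A A (J y) := by
    intro y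
    obtain ⟨z, rfl⟩ := (TensorProduct.assoc ℂ Aᵐᵒᵖ Aᵐᵒᵖ Aᵐᵒᵖ).surjective y
    induction z with
    | zero => simp
    | add u v hu hv => simp only [map_add, hu, hv]
    | tmul w x => rw [h1, LinearEquiv.symm_apply_apply, LinearEquiv.apply_symm_apply]
  have h3 : ∀ y, J' (((opFlip A).trans (H.T₁.trans (opFlip A).symm)).toLinearMap.rTensor Aᵐᵒᵖ y) =
      H.T₁.toLinearMap.lTensor A (J' y) := by
    intro y
    induction y with
    | zero => simp
    | add u v hu hv => simp only [map_add, hu, hv]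
    | tmul w x => simp [hJ']
  have h4 : ∀ y, J (((opFlip A).trans (H.T₂.trans (opFlip A).symm)).toLinearMap.lTensor Aᵐᵒᵖ y) =
      H.T₂.toLinearMap.rTensor A (J y) := by
    intro y
    induction y with
    | zero => simp
    | add u v hu hv => simp only [map_add, hu, hv]
    | tmul w x => simp [hJ]
  apply J'.injective
  rw [h3, h2, hJ, h2, h4, h1, hJ', LinearEquiv.apply_symm_apply, LinearEquiv.apply_symm_apply,
    opFlip_tmul, opFlip_tmul, H.coassoc, LinearEquiv.apply_symm_apply]

/-- The opposite algebra `Aᵒᵖ` with the opposite coproduct. -/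
def opCop (H : MultiplierHopfStarAlgebra A) : MultiplierHopfStarAlgebra Aᵐᵒᵖ where
  nondegenerate :=
    ⟨fun a h => unop_injective (H.nondegenerate.2 _ fun b => by
        simpa using congrArg unop (h (op b))),
      fun a h => unop_injective (H.nondegenerate.1 _ fun b => by
        simpa using congrArg unop (h (op b)))⟩
  comul :=
    { toFun := fun a => multiplierOpFlip (H.comul (unop a))
      map_smul' := fun r a => by
        rw [unop_smul, map_smul]
        exact multipliers_ext (fun x => (opFlip A).symm.map_smul _ _)
          (fun x => (opFlip A).symm.map_smul _ _)
      map_zero' := by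
        rw [unop_zero, map_zero]
        exact multipliers_ext (fun x => (opFlip A).symm.map_zero)
          (fun x => (opFlip A).symm.map_zero)
      map_add' := fun a b => by
        rw [unop_add, map_add]
        exact multipliers_ext (fun x => (opFlip A).symm.map_add _ _)
          (fun x => (opFlip A).symm.map_add _ _)
      map_mul' := fun a b => by rw [unop_mul, map_mul, multiplierOpFlip_mul]
      map_star' := fun a => by rw [unop_star, map_star, multiplierOpFlip_star] }
  T₁ := (opFlip A).trans (H.T₂.trans (opFlip A).symm)
  T₁_spec a b := by
    change Multipliers.of ((opFlip A).symm (H.T₂ (opFlip A (a ⊗ₜ b)))) =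
      multiplierOpFlip (H.comul (unop a)) * oneTmul b
    rw [opFlip_tmul, ← multiplierOpFlip_of, T₂_spec, multiplierOpFlip_mul,
      multiplierOpFlip_tmulOne, op_unop]
  T₂ := (opFlip A).trans (H.T₁.trans (opFlip A).symm)
  T₂_spec a b := by
    change Multipliers.of ((opFlip A).symm (H.T₁ (opFlip A (a ⊗ₜ b)))) =
      tmulOne a * multiplierOpFlip (H.comul (unop b))
    rw [opFlip_tmul, ← multiplierOpFlip_of, T₁_spec, multiplierOpFlip_mul,
      multiplierOpFlip_oneTmul, op_unop]
  coassoc a b c := H.opFlip_coassoc a b c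

theorem opCop_T₁ (H : MultiplierHopfStarAlgebra A) (a b : Aᵐᵒᵖ) :
    H.opCop.T₁ (a ⊗ₜ b) = (opFlip A).symm (H.T₂ (unop b ⊗ₜ unop a)) := by
  rw [← opFlip_tmul]
  rfl

theorem opCop_T₂ (H : MultiplierHopfStarAlgebra A) (a b : Aᵐᵒᵖ) :
    H.opCop.T₂ (a ⊗ₜ b) = (opFlip A).symm (H.T₁ (unop b ⊗ₜ unop a)) := by
  rw [← opFlip_tmul]
  rfl

/-- A linear functional on `A`, as a functional on `Aᵒᵖ`. -/
def opFunctional (ω : A →ₗ[ℂ] ℂ) : Aᵐᵒᵖ →ₗ[ℂ] ℂ := ω ∘ₗ (opLinearEquiv ℂ).symm.toLinearMap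

theorem opFunctional_apply (ω : A →ₗ[ℂ] ℂ) (a : Aᵐᵒᵖ) : opFunctional ω a = ω (unop a) := rfl

theorem sliceLeft_opFunctional (ω : A →ₗ[ℂ] ℂ) (z : A ⊗[ℂ] A) :
    sliceLeft (opFunctional ω) ((opFlip A).symm z) = op (sliceRight ω z) := by
  induction z with
  | zero => simp
  | add x y hx hy => simp only [map_add, op_add, hx, hy]
  | tmul p q => simp [opFunctional_apply]

theorem sliceRight_opFunctional (ω : A →ₗ[ℂ] ℂ) (z : A ⊗[ℂ] A) :
    sliceRight (opFunctional ω) ((opFlip A).symm z) = op (sliceLeft ω z) := by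
  induction z with
  | zero => simp
  | add x y hx hy => simp only [map_add, op_add, hx, hy]
  | tmul p q => simp [opFunctional_apply]

theorem opCop_counit (H : MultiplierHopfStarAlgebra A) :
    H.opCop.counit = opFunctional H.counit := by
  refine H.opCop.counit_unique H.opCop.isCounit_counit ⟨fun a b => ?_, fun a b => ?_⟩
  · rw [opCop_T₁, sliceLeft_opFunctional, H.isCounit_counit.2]
    rfl
  · rw [opCop_T₂, sliceRight_opFunctional, H.isCounit_counit.1]
    rfl

theorem opCop_antipode (H : MultiplierHopfStarAlgebra A) (a : Aᵐᵒᵖ) :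
    H.opCop.antipode a = op (H.antipode (unop a)) := by
  let S' : Aᵐᵒᵖ →ₗ[ℂ] Aᵐᵒᵖ :=
    (opLinearEquiv ℂ).toLinearMap ∘ₗ H.antipode ∘ₗ (opLinearEquiv ℂ).symm.toLinearMap
  have hS' : ∀ a, S' a = op (H.antipode (unop a)) := fun a => rfl
  suffices h : H.opCop.antipode = S' by rw [h, hS']
  refine H.opCop.antipode_unique H.opCop.isAntipode_antipode ⟨fun a b => ?_, fun a b => ?_⟩
  · have h : ∀ z : A ⊗[ℂ] A, LinearMap.mul' ℂ Aᵐᵒᵖ (S'.rTensor Aᵐᵒᵖ ((opFlip A).symm z)) =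
        op (LinearMap.mul' ℂ A (H.antipode.lTensor A z)) := by
      intro z
      induction z with
      | zero => simp
      | add x y hx hy => simp only [map_add, op_add, hx, hy]
      | tmul p q => simp [hS']
    rw [opCop_T₁, h, H.isAntipode_antipode.2, opCop_counit]
    rfl
  · have h : ∀ z : A ⊗[ℂ] A, LinearMap.mul' ℂ Aᵐᵒᵖ (S'.lTensor Aᵐᵒᵖ ((opFlip A).symm z)) =
        op (LinearMap.mul' ℂ A (H.antipode.rTensor A z)) := by
      intro z
      induction z with
      | zero => simp
      | add x y hx hy => simp only [map_add, op_add, hx, hy]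
      | tmul p q => simp [hS']
    rw [opCop_T₂, h, H.isAntipode_antipode.1, opCop_counit]
    rfl

theorem IsRightIntegral.opCop {ψ : A →ₗ[ℂ] ℂ} (h : H.IsRightIntegral ψ) :
    H.opCop.IsLeftIntegral (opFunctional ψ) := by
  constructor
  · intro h0
    apply h.1
    ext a
    exact LinearMap.congr_fun h0 (op a)
  · intro a b
    rw [opCop_T₂, sliceRight_opFunctional, h.2]
    rfl

/-- The product `a⋆a` in `Aᵒᵖ` is `aa⋆` in `A`, again of the form `b⋆b`. -/
theorem isPositiveFunctional_opFunctional {ω : A →ₗ[ℂ] ℂ} (hω : IsPositiveFunctional ω) :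
    IsPositiveFunctional (opFunctional ω) := by
  intro a
  simpa [opFunctional_apply] using hω (star (unop a))

/-- The left-integral case in `opCop` applies to the right integral `φ ∘ S`; surjectivity of `S`
then gives the claim for `φ`. -/
theorem IsRightIntegral.isScalingConstant_one {ψ : A →ₗ[ℂ] ℂ} (h : H.IsRightIntegral ψ)
    (hψ : IsPositiveFunctional ψ) {φ : A →ₗ[ℂ] ℂ} (hφ : H.IsLeftIntegral φ) :
    H.IsScalingConstant φ 1 := by
  intro a
  obtain ⟨a, rfl⟩ := H.antipode_surjective a
  have h1 := h.opCop.isScalingConstant_one (isPositiveFunctional_opFunctional hψ)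
    hφ.comp_antipode.opCop (op a)
  simpa [opFunctional_apply, opCop_antipode] using h1

end OpCop

end MultiplierHopfStarAlgebra

end VanDaele

end

theorem mainTheorem4 {A : Type*} [NonUnitalRing A] [Module ℂ A] [IsScalarTower ℂ A A]
    [SMulCommClass ℂ A A] [StarRing A] [StarModule ℂ A]
    (H : VanDaele.MultiplierHopfStarAlgebra A)
    (hpos : ∃ ω : A →ₗ[ℂ] ℂ, VanDaele.IsPositiveFunctional ω ∧
      (H.IsLeftIntegral ω ∨ H.IsRightIntegral ω)) :
    (∃ φ : A →ₗ[ℂ] ℂ, H.IsLeftIntegral φ) ∧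
      ∀ φ : A →ₗ[ℂ] ℂ, H.IsLeftIntegral φ →
        (∃ τ : ℂ, H.IsScalingConstant φ τ) ∧
          ∀ τ : ℂ, H.IsScalingConstant φ τ → τ = 1 := by
  obtain ⟨ω, hω, h⟩ := hpos
  have key : ∀ φ : A →ₗ[ℂ] ℂ, H.IsLeftIntegral φ → H.IsScalingConstant φ 1 := by
    intro φ hφ
    rcases h with h | h
    · exact h.isScalingConstant_one hω hφ
    · exact h.isScalingConstant_one hω hφ
  refine ⟨?_, fun φ hφ => ⟨⟨1, key φ hφ⟩, fun τ hτ => ?_⟩⟩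
  · rcases h with h | h
    · exact ⟨ω, h⟩
    · exact ⟨_, h.comp_antipode⟩
  · by_contra hne
    apply hφ.1
    ext a
    have h1 := (hτ a).symm.trans (key φ hφ a)
    have h2 : (τ - 1) * φ a = 0 := by rw [sub_mul, h1, sub_self]
    exact (mul_eq_zero.1 h2).resolve_left (sub_ne_zero.2 hne)
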